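/- All groups are finite. For a group $G$, let $F(G)$ be its Fitting subgroup, i.e. the subgroup generated by all normal nilpotent subgroups of $G$, and call $G$ $\mathcal N$-constrained if $C_G(F(G))\le F(G)$. A nilpotent injector of $G$ is a subgroup $I\le G$ such that, for every subnormal subgroup $S$ of $G$, $S\cap I$ is a maximal nilpotent subgroup of $S$. Put $m_G=1$ if $G$ is nilpotent, and otherwise $$m_G=\gcd\{\,p-1 : p \text{ prime},\ p\mid (G:I)\text{ with } I \text{ a nilpotent injector of } G\,\}.$$ For a finite poset $P$, its Möbius function $\mu_P:P\times P\to\mathbb Z$ is defined by $\mu_P(x,y)=0$ if $x\not\le y$, $\mu_P(x,x)=1$, and $\mu_P(x,y)=-\sum_{x\le z<y}\mu_P(x,z)$ if $x<y$; put $\theta_P(x)=\sum_{y\in P}\mu_P(x,y)$. Let $G$ be a nontrivial finite $\mathcal N$-constrained group, let $I$ be a nilpotent injector of $G$, and let $\mathcal X$ be the set of all subgroups of $G$ that are contained in some conjugate of $I$, ordered by inclusion. Let $n=(I:F(G))$ and suppose $n>1$. Then $F(G)\in\mathcal X$, and $\mathrm{lcm}(m_G,n)$ divides $\theta_{\mathcal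 X}(F(G))$. -/

import Mathlib

/-- The Fitting subgroup of a (finite) group: the subgroup generated by all normal nilpotent
subgroups. -/
def fittingSubgroup (G : Type*) [Group G] : Subgroup G :=
  sSup {N : Subgroup G | N.Normal ∧ Group.IsNilpotent N}

/-- `G` is `𝒩`-constrained: the Fitting subgroup contains its own centralizer in `G`. -/
def IsNConstrained (G : Type*) [Group G] : Prop :=
  Subgroup.centralizer (fittingSubgroup G : Set G) ≤ fittingSubgroup G

/-- `I` is a nilpotent injector of `G`: for every subnormal subgroup `S` of `G`, the intersection
`S ∩ I` is maximal among the nilpotent subgroups of `S`. -/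
def IsNilpotentInjector {G : Type*} [Group G] (I : Subgroup G) : Prop :=
  ∀ S : Subgroup G, S.IsSubnormal →
    Maximal (fun K : Subgroup G => K ≤ S ∧ Group.IsNilpotent K) (S ⊓ I)

open Classical in
/-- The number `m_G` of a finite group `G`: it is `1` if `G` is nilpotent, and otherwise the
greatest common divisor of the numbers `p - 1`, where `p` runs over the primes dividing `(G : I)`
with `I` a nilpotent injector of `G` (such primes divide the order of `G`). -/
noncomputable def injectorModulus (G : Type*) [Group G] : ℕ :=
  if Group.IsNilpotent G then 1
  else
    ((Nat.card G).primeFactors.filter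
      (fun p => ∃ I : Subgroup G, IsNilpotentInjector I ∧ p ∣ I.index)).gcd (fun p => p - 1)

/-- The set of all subgroups of `G` that are contained in some conjugate of `I`. -/
def subgroupsOfConjugates {G : Type*} [Group G] (I : Subgroup G) : Set (Subgroup G) :=
  {H | ∃ g : G, H ≤ I.map (MulAut.conj g).toMonoidHom}

open Classical in
/-- The Möbius function `μ_P` of a finite poset `P`. -/
noncomputable def posetMoebius {P : Type*} [PartialOrder P] [Finite P] (x y : P) : ℤ :=
  letI : Fintype P := Fintype.ofFinite P
  letI : LocallyFiniteOrder P := Fintype.toLocallyFiniteOrder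
  IncidenceAlgebra.mu ℤ x y

/-- `θ_P(x) = ∑_{y ∈ P} μ_P(x, y)` for a finite poset `P`. -/
noncomputable def posetTheta {P : Type*} [PartialOrder P] [Finite P] (x : P) : ℤ :=
  ∑ᶠ y : P, posetMoebius x y

/-!
Write `θ` for `posetTheta`. Let `I` be a maximal nilpotent subgroup of `G`, and `F ≤ I` a normal
subgroup of `G` with `C_G(F) ≤ F`. For a prime `p` let `C_p` be the image in `G ⧸ F` of the
centralizer of the `p'`-elements of `F`. These normal subgroups are independent, and a subgroup
`K ≥ F` is nilpotent exactly when `K ⧸ F` is a direct product of `p`-subgroups of the `C_p`. By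
Sylow's theorem in every `C_p`, each such `K` lies in a conjugate of `I`. As `θ_X(F)` depends only
on the members of `X` above `F` and `θ` is multiplicative, `θ_X(F)` is divisible, for every `p`, by
`θ(1)` in the poset of all `p`-subgroups of `C_p`.

For the `p`-subgroups of a finite group `H`, counting pairs `x ∈ A` gives
`θ(1) + ∑_{A ≠ 1} |A| θ(A) = #{p-elements of H}`, and `θ(A)` is the value of `θ` at the trivial
subgroup of `N_H(A) ⧸ A`, so one can induct on `|H|`.
* The `p`-part of `|H|` divides the right hand side by Frobenius' theorem, and divides the
  sum of `|A| θ(A)` over each conjugacy class by induction, hence divides `θ(1)` (Brown).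
* Suppose `p ∣ |H|` and `q ≡ 1 [MOD m]` for every prime `q ≠ p` dividing `|H|`. Modulo `m` both the
  right hand side and the contribution of the Sylow subgroups are `|H|`, and the remaining `θ(A)`
  vanish by induction, so `m ∣ θ(1)`.

The first bullet gives divisibility by `(I : F)`, the second applied to one prime `p` dividing
`(I : F)` gives divisibility by `m_G`: the subgroup `I` meets `C_p` in a `p`-group, so the primes
`q ≠ p` dividing `|C_p|` divide `(G : I)`.
-/

section PosetTheta

variable {P Q : Type*} [PartialOrder P] [PartialOrder Q]

open Classical in
theorem sum_posetMoebius_ge [Fintype P] (x y : P) :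
    ∑ z with x ≤ z, posetMoebius z y = if x = y then 1 else 0 := by
  let _ : Fintype P := Fintype.ofFinite P
  let _ : LocallyFiniteOrder P := Fintype.toLocallyFiniteOrder
  unfold posetMoebius
  rw [← IncidenceAlgebra.sum_Icc_mu_left (𝕜 := ℤ) x y]
  refine (Finset.sum_subset_zero_on_sdiff ?_ ?_ fun _ _ => rfl).symm
  · exact fun z hz => by simp [(Finset.mem_Icc.1 hz).1]
  · intro z hz
    simp only [Finset.mem_sdiff, Finset.mem_filter, Finset.mem_univ, true_and, Finset.mem_Icc,
      not_and] at hz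
    exact IncidenceAlgebra.apply_eq_zero_of_not_le (hz.2 hz.1) _

open Classical in
theorem sum_posetTheta_ge [Fintype P] (x : P) : ∑ z with x ≤ z, posetTheta z = 1 := by
  simp only [posetTheta, finsum_eq_sum_of_fintype]
  rw [Finset.sum_comm]
  simp [sum_posetMoebius_ge]

open Classical in
theorem eq_posetTheta_of_forall_sum_ge_eq_one [Fintype P] {h : P → ℤ}
    (hh : ∀ x, ∑ z with x ≤ z, h z = 1) (x : P) : h x = posetTheta x := by
  induction x using WellFoundedGT.induction with
  | ind x ih =>
    have ge_eq_insert : Finset.univ.filter (x ≤ ·) = insert x (Finset.univ.filter (x < ·)) := by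
      ext z
      simp [le_iff_eq_or_lt, eq_comm]
    have sum_eq := (hh x).trans (sum_posetTheta_ge x).symm
    rw [ge_eq_insert, Finset.sum_insert (by simp), Finset.sum_insert (by simp),
      Finset.sum_congr rfl fun z hz => ih z (by simpa using hz)] at sum_eq
    exact add_right_cancel sum_eq

open Classical in
theorem posetTheta_eq_sum_of_galoisConnection [Fintype P] [Finite Q] {l : Q → P} {u : P → Q}
    (gc : GaloisConnection l u) (b : Q) : posetTheta b = ∑ a with u a = b, posetTheta a := by
  let _ := Fintype.ofFinite Q
  refine (eq_posetTheta_of_forall_sum_ge_eq_one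
    (h := fun b => ∑ a with u a = b, posetTheta a) (fun y => ?_) b).symm
  rw [← sum_posetTheta_ge (l y)]
  simp only [Finset.sum_filter, gc y _]
  rw [← Finset.sum_fiberwise Finset.univ u]
  refine Finset.sum_congr rfl fun b _ => ?_
  rw [Finset.sum_filter]
  split_ifs with hb
  · exact Finset.sum_congr rfl fun a _ => by split_ifs <;> simp_all
  · exact (Finset.sum_eq_zero fun a _ => by split_ifs <;> simp_all).symm

theorem posetTheta_eq_of_galoisConnection [Finite P] [Finite Q] {l : Q → P} {u : P → Q}
    (gc : GaloisConnection l u) {a : P} {b : Q} (h : ∀ a', u a' = b ↔ a' = a) :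
    posetTheta b = posetTheta a := by
  classical
  let _ := Fintype.ofFinite P
  rw [posetTheta_eq_sum_of_galoisConnection gc b, Finset.filter_congr fun a' _ => h a',
    Finset.sum_filter, Finset.sum_ite_eq' Finset.univ a, if_pos (Finset.mem_univ a)]

theorem posetTheta_apply_of_isUpperSet_range [Finite P] [Finite Q] (e : P ↪o Q)
    (he : IsUpperSet (Set.range e)) (x : P) : posetTheta (e x) = posetTheta x := by
  classical
  let _ := Fintype.ofFinite P
  let _ := Fintype.ofFinite Q
  refine eq_posetTheta_of_forall_sum_ge_eq_one (h := posetTheta ∘ e) (fun x => ?_) x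
  rw [← sum_posetTheta_ge (e x)]
  refine Finset.sum_bij (fun z _ => e z) (by simp) (fun _ _ _ _ h => e.injective h) ?_
    fun _ _ => rfl
  intro y hy
  obtain ⟨z, rfl⟩ := he (by simpa using hy) (Set.mem_range_self x)
  exact ⟨z, by simpa using hy, rfl⟩

theorem posetTheta_orderIso [Finite P] [Finite Q] (e : P ≃o Q) (x : P) :
    posetTheta (e x) = posetTheta x :=
  posetTheta_apply_of_isUpperSet_range e.toOrderEmbedding (fun _ b _ _ => ⟨e.symm b, by simp⟩) x

theorem posetTheta_prod [Finite P] [Finite Q] (x : P × Q) :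
    posetTheta x = posetTheta x.1 * posetTheta x.2 := by
  classical
  let _ := Fintype.ofFinite P
  let _ := Fintype.ofFinite Q
  refine (eq_posetTheta_of_forall_sum_ge_eq_one
    (h := fun z : P × Q => posetTheta z.1 * posetTheta z.2) (fun x => ?_) x).symm
  refine (Finset.sum_congr (s₂ := Finset.univ.filter (x.1 ≤ ·) ×ˢ Finset.univ.filter (x.2 ≤ ·))
    (by ext z; simp [Prod.le_def]) fun _ _ => rfl).trans ?_
  rw [Finset.sum_product, ← Finset.sum_mul_sum, sum_posetTheta_ge, sum_posetTheta_ge, one_mul]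

theorem posetTheta_eq_one_of_isMax [Finite P] {x : P} (hx : IsMax x) : posetTheta x = 1 := by
  classical
  let _ := Fintype.ofFinite P
  have ge_eq_singleton : Finset.univ.filter (x ≤ ·) = {x} := by
    ext z
    simpa using ⟨fun h => (hx.eq_of_le h).symm, fun h => h.ge⟩
  rw [← sum_posetTheta_ge x, ge_eq_singleton, Finset.sum_singleton]

end PosetTheta

section PowerTorsion

variable {G : Type*} [Group G] {a b : ℕ}

theorem eq_one_of_pow_eq_one_of_coprime (hab : a.Coprime b) {x : G} (ha : x ^ a = 1)
    (hb : x ^ b = 1) : x = 1 := by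
  simpa [hab.gcd_eq_one] using pow_gcd_eq_one.2 ⟨ha, hb⟩

/-- An exponent that is `1` modulo `a` and `0` modulo `b`. Raising to it projects an element of
order dividing `a * b` onto its part of order dividing `a`. -/
def coprimeExponent (hab : a.Coprime b) : ℕ := Nat.chineseRemainder hab 1 0

theorem dvd_coprimeExponent (hab : a.Coprime b) : b ∣ coprimeExponent hab :=
  Nat.modEq_zero_iff_dvd.1 (Nat.chineseRemainder hab 1 0).2.2

theorem pow_coprimeExponent_eq_self (hab : a.Coprime b) {x : G} (hx : x ^ a = 1) :
    x ^ coprimeExponent hab = x := by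
  conv_rhs => rw [← pow_one x]
  exact pow_eq_pow_iff_modEq.2
    (Nat.ModEq.of_dvd (orderOf_dvd_of_pow_eq_one hx) (Nat.chineseRemainder hab 1 0).2.1)

theorem pow_coprimeExponent_eq_one (hab : a.Coprime b) {x : G} (hx : x ^ b = 1) :
    x ^ coprimeExponent hab = 1 :=
  orderOf_dvd_iff_pow_eq_one.1 ((orderOf_dvd_of_pow_eq_one hx).trans (dvd_coprimeExponent hab))

theorem pow_coprimeExponent_pow_eq_one (hab : a.Coprime b) {x : G} (hx : x ^ (a * b) = 1) :
    (x ^ coprimeExponent hab) ^ a = 1 := by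
  rw [← pow_mul, mul_comm, ← orderOf_dvd_iff_pow_eq_one]
  exact (orderOf_dvd_of_pow_eq_one hx).trans (mul_dvd_mul_left a (dvd_coprimeExponent hab))

theorem pow_coprimeExponent_mul_pow_coprimeExponent (hab : a.Coprime b) {x : G}
    (hx : x ^ (a * b) = 1) : x ^ coprimeExponent hab * x ^ coprimeExponent hab.symm = x := by
  have modEq_one : coprimeExponent hab + coprimeExponent hab.symm ≡ 1 [MOD a * b] :=
    (Nat.modEq_and_modEq_iff_modEq_mul hab).1
      ⟨(Nat.chineseRemainder hab 1 0).2.1.add (Nat.chineseRemainder hab.symm 1 0).2.2,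
        (Nat.chineseRemainder hab 1 0).2.2.add (Nat.chineseRemainder hab.symm 1 0).2.1⟩
  rw [← pow_add]
  conv_rhs => rw [← pow_one x]
  exact pow_eq_pow_iff_modEq.2 (modEq_one.of_dvd (orderOf_dvd_of_pow_eq_one hx))

open Classical in
theorem sum_card_commute_pow_eq_one [Fintype G] (hab : a.Coprime b) :
    ∑ y : G with y ^ b = 1, (Finset.univ.filter fun x : G => Commute x y ∧ x ^ a = 1).card =
      (Finset.univ.filter fun g : G => g ^ (a * b) = 1).card := by
  rw [Finset.card_eq_sum_card_fiberwise (f := (· ^ coprimeExponent hab.symm))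
    (t := Finset.univ.filter fun y : G => y ^ b = 1)
    fun g hg => by
      simpa using pow_coprimeExponent_pow_eq_one hab.symm (by simpa [mul_comm] using hg)]
  refine Finset.sum_congr rfl fun y hy => ?_
  replace hy : y ^ b = 1 := by simpa using hy
  refine Finset.card_nbij' (· * y) (· ^ coprimeExponent hab) ?_ ?_ ?_ ?_
  · intro x hx
    obtain ⟨hxy, hx⟩ : Commute x y ∧ x ^ a = 1 := by simpa using hx
    have mul_pow_eq_one : (x * y) ^ (a * b) = 1 := by
      rw [hxy.mul_pow, pow_mul, hx, one_pow, mul_comm a b, pow_mul, hy, one_pow, one_mul]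
    simp [mul_pow_eq_one, hxy.mul_pow, pow_coprimeExponent_eq_one hab.symm hx,
      pow_coprimeExponent_eq_self hab.symm hy]
  · intro g hg
    obtain ⟨hg, hgy⟩ : g ^ (a * b) = 1 ∧ g ^ coprimeExponent hab.symm = y := by simpa using hg
    simpa using ⟨hgy ▸ Commute.pow_pow_self g _ _, pow_coprimeExponent_pow_eq_one hab hg⟩
  · intro x hx
    obtain ⟨hxy, hx⟩ : Commute x y ∧ x ^ a = 1 := by simpa using hx
    simp [hxy.mul_pow, pow_coprimeExponent_eq_self hab hx, pow_coprimeExponent_eq_one hab hy]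
  · intro g hg
    obtain ⟨hg, hgy⟩ : g ^ (a * b) = 1 ∧ g ^ coprimeExponent hab.symm = y := by simpa using hg
    exact hgy ▸ pow_coprimeExponent_mul_pow_coprimeExponent hab hg

/-- The `n`-torsion of a commutative subgroup, as a subgroup of the ambient group. -/
def commTorsion (A : Subgroup G) [IsMulCommutative A] (n : ℕ) : Subgroup G where
  carrier := {x | x ∈ A ∧ x ^ n = 1}
  one_mem' := ⟨one_mem A, one_pow n⟩
  mul_mem' {x y} hx hy := ⟨mul_mem hx.1 hy.1, by
    have hxy : Commute x y := setLike_mul_comm hx.1 hy.1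
    rw [hxy.mul_pow, hx.2, hy.2, one_mul]⟩
  inv_mem' {x} hx := ⟨inv_mem hx.1, by rw [inv_pow, hx.2, inv_one]⟩

instance commTorsion_normal (A : Subgroup G) [IsMulCommutative A] [hA : A.Normal] (n : ℕ) :
    (commTorsion A n).Normal where
  conj_mem x hx g := ⟨hA.conj_mem x hx.1 g, by rw [conj_pow, hx.2, mul_one, mul_inv_cancel]⟩

theorem not_dvd_card_commTorsion [Finite G] {A : Subgroup G} [IsMulCommutative A] {p n : ℕ}
    (hp : p.Prime) (hn : ¬ p ∣ n) : ¬ p ∣ Nat.card (commTorsion A n) := by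
  intro hdvd
  have := Fact.mk hp
  obtain ⟨z, hz⟩ := exists_prime_orderOf_dvd_card' p hdvd
  exact hn (hz ▸ orderOf_dvd_of_pow_eq_one (Subtype.ext z.2.2))

end PowerTorsion

section PElements

variable {p : ℕ} {G H : Type*} [Group G] [Group H]

/-- The elements of `p`-power order. -/
def IsPElement (p : ℕ) (x : G) : Prop := ∃ k, x ^ p ^ k = 1

theorem isPElement_map_iff {φ : G →* H} (hφ : Function.Injective φ) {x : G} :
    IsPElement p (φ x) ↔ IsPElement p x := by
  simp only [IsPElement, ← map_pow, map_eq_one_iff φ hφ]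

theorem isPElement_coe {K : Subgroup G} {x : K} : IsPElement p (x : G) ↔ IsPElement p x :=
  isPElement_map_iff K.subtype_injective

theorem IsPElement.map {x : G} (hx : IsPElement p x) (φ : G →* H) : IsPElement p (φ x) := by
  obtain ⟨k, hk⟩ := hx
  exact ⟨k, by rw [← map_pow, hk, map_one]⟩

theorem IsPElement.isPGroup_zpowers {x : G} (hx : IsPElement p x) :
    IsPGroup p (Subgroup.zpowers x) := by
  obtain ⟨k, hk⟩ := hx
  exact IsPGroup.of_card_dvd_pow (Nat.card_zpowers x ▸ orderOf_dvd_of_pow_eq_one hk)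

theorem IsPElement.pow_ordProj_eq_one (hp : p.Prime) {n : ℕ} (hn : n ≠ 0) {x : G}
    (hx : IsPElement p x) (hxn : x ^ n = 1) : x ^ ordProj[p] n = 1 := by
  obtain ⟨k, hk⟩ := hx
  obtain ⟨j, _, hj⟩ := (Nat.dvd_prime_pow hp).1 (orderOf_dvd_of_pow_eq_one hk)
  rw [← orderOf_dvd_iff_pow_eq_one, hj]
  exact pow_dvd_pow _ ((hp.pow_dvd_iff_le_factorization hn).1 (hj ▸ orderOf_dvd_of_pow_eq_one hxn))

theorem isPElement_iff_pow_ordProj_card_eq_one (hp : p.Prime) [Finite G] {x : G} :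
    IsPElement p x ↔ x ^ ordProj[p] (Nat.card G) = 1 :=
  ⟨fun hx => hx.pow_ordProj_eq_one hp Nat.card_pos.ne' pow_card_eq_one', fun hx => ⟨_, hx⟩⟩

/-- The number of `p`-elements of a group. -/
noncomputable def pElementCount (p : ℕ) (G : Type*) [Group G] : ℕ :=
  Nat.card {x : G // IsPElement p x}

theorem pElementCount_congr (p : ℕ) (e : G ≃* H) : pElementCount p G = pElementCount p H :=
  Nat.card_congr <| e.toEquiv.subtypeEquiv fun _ =>
    (isPElement_map_iff (φ := e.toMonoidHom) e.injective).symm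

theorem pElementCount_centralizer_of_mem_center (p : ℕ) {y : G} (hy : y ∈ Subgroup.center G) :
    pElementCount p (Subgroup.centralizer {y}) = pElementCount p G := by
  rw [Subgroup.centralizer_eq_top_iff_subset.2 (Set.singleton_subset_iff.2 hy)]
  exact pElementCount_congr p Subgroup.topEquiv

theorem pElementCount_centralizer_conj (p : ℕ) (g y : G) :
    pElementCount p (Subgroup.centralizer {g * y * g⁻¹}) =
      pElementCount p (Subgroup.centralizer {y}) := by
  have map_centralizer : (Subgroup.centralizer {y}).map (MulAut.conj g).toMonoidHom =
      Subgroup.centralizer {g * y * g⁻¹} := by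
    ext x
    rw [Subgroup.mem_map_equiv, Subgroup.mem_centralizer_singleton_iff,
      Subgroup.mem_centralizer_singleton_iff, MulAut.conj_symm_apply,
      ← mul_right_inj g, ← mul_left_inj g⁻¹]
    simp only [mul_assoc, mul_inv_cancel_left, mul_inv_cancel, mul_one]
  rw [← map_centralizer]
  exact (pElementCount_congr p ((MulAut.conj g).subgroupMap _)).symm

theorem coprime_ordProj_ordCompl_card (hp : p.Prime) (G : Type*) [Group G] [Finite G] :
    (ordProj[p] (Nat.card G)).Coprime (ordCompl[p] (Nat.card G)) :=
  (Nat.coprime_ordCompl hp Nat.card_pos.ne').pow_left _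

open Classical in
theorem sum_pElementCount_centralizer [Fintype G] (hp : p.Prime) :
    ∑ y : G with y ^ ordCompl[p] (Nat.card G) = 1, pElementCount p (Subgroup.centralizer {y}) =
      Nat.card G := by
  have count := sum_card_commute_pow_eq_one (G := G) (coprime_ordProj_ordCompl_card hp G)
  simp only [Nat.ordProj_mul_ordCompl_eq_self, pow_card_eq_one', Finset.filter_true,
    Finset.card_univ, ← Nat.card_eq_fintype_card] at count
  refine Eq.trans ?_ count
  refine Finset.sum_congr rfl fun y _ => ?_
  rw [← Fintype.card_subtype, ← Nat.card_eq_fintype_card, pElementCount]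
  refine Nat.card_congr ⟨fun x => ⟨x.1.1, Subgroup.mem_centralizer_singleton_iff.1 x.1.2,
    (isPElement_iff_pow_ordProj_card_eq_one hp).1 (isPElement_coe.2 x.2)⟩,
    fun x => ⟨⟨x.1, Subgroup.mem_centralizer_singleton_iff.2 x.2.1⟩,
      isPElement_coe.1 ((isPElement_iff_pow_ordProj_card_eq_one hp).2 x.2.2)⟩,
    fun _ => rfl, fun _ => rfl⟩

end PElements

section OrbitSums

variable {G T R : Type*} [Group G] [MulAction G T] [CommSemiring R]

open MulAction in
theorem dvd_sum_of_forall_dvd_index_stabilizer_mul [Fintype T] {d : R} {f : T → R}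
    (hf : ∀ (g : G) t, f (g • t) = f t) (hd : ∀ t, d ∣ (stabilizer G t).index * f t) :
    d ∣ ∑ t, f t := by
  classical
  rw [← Finset.sum_fiberwise Finset.univ (Quotient.mk (orbitRel G T))]
  refine Finset.dvd_sum fun ω _ => ?_
  obtain ⟨t, rfl⟩ := Quotient.exists_rep ω
  have mem_orbit : ∀ t', t' ∈ Finset.univ.filter (fun t' => (⟦t'⟧ : orbitRel.Quotient G T) = ⟦t⟧) ↔
      t' ∈ orbit G t := fun t' => by
    simp only [Finset.mem_filter, Finset.mem_univ, true_and, Quotient.eq, orbitRel_apply]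
  have card_fiber : (Finset.univ.filter fun t' => (⟦t'⟧ : orbitRel.Quotient G T) = ⟦t⟧).card =
      (stabilizer G t).index := by
    rw [index_stabilizer, ← Set.ncard_coe_finset]
    exact congrArg Set.ncard (Set.ext fun t' => mem_orbit t')
  have f_const : ∀ t' ∈ Finset.univ.filter (fun t' => (⟦t'⟧ : orbitRel.Quotient G T) = ⟦t⟧),
      f t' = f t := fun t' ht' => by
    obtain ⟨g, rfl⟩ := (mem_orbit t').1 ht'
    exact hf g t
  rw [Finset.sum_congr rfl f_const, Finset.sum_const, card_fiber, nsmul_eq_mul]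
  exact hd t

theorem ordProj_card_dvd_index_mul_ordProj_card [Finite G] (p : ℕ) (K : Subgroup G) :
    ordProj[p] (Nat.card G) ∣ K.index * ordProj[p] (Nat.card K) := by
  rw [← K.index_mul_card, Nat.ordProj_mul p Subgroup.index_ne_zero_of_finite Nat.card_pos.ne']
  exact mul_dvd_mul_right (Nat.ordProj_dvd _ _) _

end OrbitSums

section PElementCount

variable {p : ℕ} {G : Type*} [Group G]

open Classical in
theorem ordProj_dvd_sum_pElementCount_centralizer_noncentral [Fintype G] (b : ℕ)
    (h : ∀ y ∉ Subgroup.center G, ordProj[p] (Nat.card (Subgroup.centralizer {y})) ∣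
      pElementCount p (Subgroup.centralizer {y})) :
    ordProj[p] (Nat.card G) ∣ ∑ y : G with y ^ b = 1 ∧ y ∉ Subgroup.center G,
      pElementCount p (Subgroup.centralizer {y}) := by
  rw [Finset.sum_filter]
  refine dvd_sum_of_forall_dvd_index_stabilizer_mul (G := ConjAct G) (fun g y => ?_) fun y => ?_
  · have pow_iff : (g • y) ^ b = 1 ↔ y ^ b = 1 := by
      rw [← smul_pow', smul_eq_iff_eq_inv_smul, smul_one]
    have center_iff : g • y ∈ Subgroup.center G ↔ y ∈ Subgroup.center G :=
      (inferInstance : (Subgroup.center G).Normal).mem_comm_iff.trans (by simp)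
    simp only [pow_iff, center_iff]
    rw [ConjAct.smul_def, pElementCount_centralizer_conj]
  · have index_eq : (MulAction.stabilizer (ConjAct G) y).index =
        (Subgroup.centralizer {y}).index := by
      rw [ConjAct.stabilizer_eq_centralizer]
      rfl
    split_ifs with hy
    · rw [index_eq]
      exact (ordProj_card_dvd_index_mul_ordProj_card p _).trans (mul_dvd_mul_left _ (h y hy.2))
    · exact dvd_zero _

open Classical in
theorem not_dvd_card_filter_center_pow_eq_one [Fintype G] (hp : p.Prime) {b : ℕ} (hb : ¬ p ∣ b) :
    ¬ p ∣ (Finset.univ.filter fun y : G => y ^ b = 1 ∧ y ∈ Subgroup.center G).card := by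
  convert not_dvd_card_commTorsion (A := Subgroup.center G) hp hb using 2
  rw [← Fintype.card_subtype, ← Nat.card_eq_fintype_card]
  exact Nat.card_congr (Equiv.subtypeEquivRight fun y => and_comm)

theorem card_centralizer_lt_card [Finite G] {y : G} (hy : y ∉ Subgroup.center G) :
    Nat.card (Subgroup.centralizer {y}) < Nat.card G :=
  (Subgroup.card_le_card_group _).lt_of_ne fun h => hy <| Set.singleton_subset_iff.1 <|
    Subgroup.centralizer_eq_top_iff_subset.1 (Subgroup.eq_top_of_card_eq _ h)

/-- Frobenius' theorem: in the class equation for the `p'`-elements, the `p`-elements of `G` are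
counted once for every central `p'`-element, and the number of those is prime to `p`. -/
theorem ordProj_dvd_pElementCount (hp : p.Prime) (G : Type*) [Group G] [Finite G] :
    ordProj[p] (Nat.card G) ∣ pElementCount p G := by
  classical
  induction hn : Nat.card G using Nat.strong_induction_on generalizing G with
  | _ n ih =>
  subst hn
  let _ := Fintype.ofFinite G
  have noncentral := ordProj_dvd_sum_pElementCount_centralizer_noncentral (p := p)
    (ordCompl[p] (Nat.card G)) fun y hy => ih _ (card_centralizer_lt_card hy) _ rfl
  have total := sum_pElementCount_centralizer (G := G) hp
  rw [← Finset.sum_filter_add_sum_filter_not _ (fun y => y ∈ Subgroup.center G),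
    Finset.filter_filter, Finset.filter_filter, Finset.sum_congr rfl fun y hy =>
      pElementCount_centralizer_of_mem_center p (Finset.mem_filter.1 hy).2.2,
    Finset.sum_const, smul_eq_mul] at total
  have central := (Nat.dvd_add_left noncentral).1 (by
    rw [total]; exact Nat.ordProj_dvd _ _)
  exact Nat.Coprime.dvd_of_dvd_mul_left (hp.coprime_pow_of_not_dvd
    (not_dvd_card_filter_center_pow_eq_one hp (Nat.not_dvd_ordCompl hp Nat.card_pos.ne'))).symm
    central

theorem modEq_one_of_forall_prime {m d : ℕ} (hd : d ≠ 0)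
    (h : ∀ q, q.Prime → q ∣ d → m ∣ q - 1) : d ≡ 1 [MOD m] := by
  induction d using Nat.recOnMul with
  | zero => exact (hd rfl).elim
  | one => rfl
  | prime q hq => exact ((Nat.modEq_iff_dvd' hq.one_le).2 (h q hq dvd_rfl)).symm
  | mul a b ha hb =>
    obtain ⟨ha0, hb0⟩ := mul_ne_zero_iff.1 hd
    simpa using (ha ha0 fun q hq hqa => h q hq (hqa.mul_right _)).mul
      (hb hb0 fun q hq hqb => h q hq (hqb.mul_left _))

theorem dvd_totient_of_forall_prime {m k : ℕ} (hk : k ≠ 1)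
    (h : ∀ q, q.Prime → q ∣ k → m ∣ q - 1) : m ∣ k.totient := by
  obtain ⟨q, hq, hqk⟩ := Nat.exists_prime_and_dvd hk
  exact (h q hq hqk).trans (Nat.totient_prime hq ▸ Nat.totient_dvd_of_dvd hqk)

open Classical in
theorem card_filter_zpowers_eq [Fintype G] (y : G) :
    (Finset.univ.filter fun x : G => Subgroup.zpowers x = Subgroup.zpowers y).card =
      (orderOf y).totient := by
  rw [← IsCyclic.card_orderOf_eq_totient (α := Subgroup.zpowers y) (d := orderOf y)
    (by rw [← Nat.card_eq_fintype_card, Nat.card_zpowers])]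
  refine (Finset.card_bij (fun x _ => x.1) ?_ (fun _ _ _ _ => Subtype.ext) ?_).symm
  · intro x hx
    simp only [Finset.mem_filter, Finset.mem_univ, true_and] at hx ⊢
    refine Subgroup.eq_of_le_of_card_ge (by simp) ?_
    rw [Nat.card_zpowers, Nat.card_zpowers, Subgroup.orderOf_coe, hx]
  · intro x hx
    simp only [Finset.mem_filter, Finset.mem_univ, true_and] at hx
    refine ⟨⟨x, hx ▸ Subgroup.mem_zpowers x⟩, ?_, rfl⟩
    simp only [Finset.mem_filter, Finset.mem_univ, true_and, Subgroup.orderOf_mk]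
    rw [← Nat.card_zpowers, hx, Nat.card_zpowers]

open Classical in
theorem dvd_sum_of_forall_dvd_totient_orderOf [Fintype G] {R : Type*} [CommSemiring R] {d : R}
    {f : G → R} (hf : ∀ x y, Subgroup.zpowers x = Subgroup.zpowers y → f x = f y)
    (hd : ∀ y, d ∣ (orderOf y).totient * f y) : d ∣ ∑ y, f y := by
  rw [← Finset.sum_fiberwise _ Subgroup.zpowers]
  refine Finset.dvd_sum fun K _ => ?_
  rcases (Finset.univ.filter fun x : G => Subgroup.zpowers x = K).eq_empty_or_nonempty
    with h | ⟨y, hy⟩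
  · simp [h]
  · obtain rfl : Subgroup.zpowers y = K := by simpa using hy
    rw [Finset.sum_congr rfl fun x hx => hf x y (Finset.mem_filter.1 hx).2, Finset.sum_const,
      card_filter_zpowers_eq, nsmul_eq_mul]
    exact hd y

theorem pElementCount_modEq_card [Finite G] (hp : p.Prime) {m : ℕ}
    (hm : ∀ q, q.Prime → q ≠ p → q ∣ Nat.card G → m ∣ q - 1) :
    pElementCount p G ≡ Nat.card G [MOD m] := by
  classical
  let _ := Fintype.ofFinite G
  have total := sum_pElementCount_centralizer (G := G) hp
  set b := ordCompl[p] (Nat.card G) with hb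
  have nontrivial : m ∣ ∑ y : G, if y ^ b = 1 ∧ y ≠ 1 then
      pElementCount p (Subgroup.centralizer {y}) else 0 := by
    refine dvd_sum_of_forall_dvd_totient_orderOf (fun x y hxy => ?_) fun y => ?_
    · have orderOf_eq : orderOf x = orderOf y := by rw [← Nat.card_zpowers, hxy, Nat.card_zpowers]
      have centralizer_eq : Subgroup.centralizer {x} = Subgroup.centralizer {y} := by
        rw [← Subgroup.centralizer_closure {x}, ← Subgroup.centralizer_closure {y},
          ← Subgroup.zpowers_eq_closure, ← Subgroup.zpowers_eq_closure, hxy]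
      have eq_one_iff : x = 1 ↔ y = 1 := by
        rw [← orderOf_eq_one_iff, orderOf_eq, orderOf_eq_one_iff]
      simp only [← orderOf_dvd_iff_pow_eq_one, ne_eq, eq_one_iff, orderOf_eq]
      rw [centralizer_eq]
    · split_ifs with hy
      · refine (dvd_totient_of_forall_prime (by simpa using hy.2) fun q hq hqy => ?_).mul_right _
        have hqb : q ∣ b := hqy.trans (orderOf_dvd_of_pow_eq_one hy.1)
        refine hm q hq ?_ (hqb.trans (Nat.ordCompl_dvd _ _))
        rintro rfl
        exact Nat.not_dvd_ordCompl hp Nat.card_pos.ne' hqb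
      · exact dvd_zero _
  rw [← Finset.sum_filter_add_sum_filter_not _ (· = 1), Finset.filter_filter, Finset.filter_filter,
    Finset.filter_congr fun y _ => and_iff_right_of_imp (by rintro rfl; exact one_pow b),
    Finset.sum_filter, Finset.sum_ite_eq' Finset.univ 1, if_pos (Finset.mem_univ 1),
    pElementCount_centralizer_of_mem_center p (one_mem _)] at total
  rw [← Finset.sum_filter] at nontrivial
  rw [← total]
  simpa using (Nat.ModEq.refl (pElementCount p G)).add (Nat.modEq_zero_iff_dvd.2 nontrivial).symm

end PElementCount

section WeylGroup

variable {G : Type*} [Group G]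

/-- The quotient `N_G(A) / A`. -/
abbrev NormalizerQuotient (A : Subgroup G) : Type _ :=
  Subgroup.normalizer (A : Set G) ⧸ A.subgroupOf (Subgroup.normalizer (A : Set G))

theorem card_normalizerQuotient_mul_card (A : Subgroup G) :
    Nat.card (NormalizerQuotient A) * Nat.card A =
      Nat.card (Subgroup.normalizer (A : Set G)) := by
  rw [Subgroup.card_eq_card_quotient_mul_card_subgroup
    (A.subgroupOf (Subgroup.normalizer (A : Set G))),
    Nat.card_congr (Subgroup.subgroupOfEquivOfLe A.le_normalizer).toEquiv]

theorem card_normalizerQuotient_dvd_card (A : Subgroup G) :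
    Nat.card (NormalizerQuotient A) ∣ Nat.card G :=
  (Dvd.intro _ (card_normalizerQuotient_mul_card A)).trans (Subgroup.card_subgroup_dvd_card _)

theorem card_normalizerQuotient_lt_card [Finite G] {A : Subgroup G} (hA : A ≠ ⊥) :
    Nat.card (NormalizerQuotient A) < Nat.card G :=
  calc Nat.card (NormalizerQuotient A)
    _ < Nat.card (NormalizerQuotient A) * Nat.card A :=
        lt_mul_of_one_lt_right Nat.card_pos ((Subgroup.one_lt_card_iff_ne_bot A).2 hA)
    _ = Nat.card (Subgroup.normalizer (A : Set G)) := card_normalizerQuotient_mul_card A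
    _ ≤ Nat.card G := Subgroup.card_le_card_group _

theorem eq_of_inf_normalizer_eq {A B : Subgroup G} (hB : NormalizerCondition B)
    (h : B ⊓ Subgroup.normalizer (A : Set G) = A) : B = A := by
  have hAB : A ≤ B := h ▸ inf_le_left
  refine le_antisymm (Subgroup.subgroupOf_eq_top.1 ?_) hAB
  refine normalizerCondition_iff_only_full_group_self_normalizing.1 hB _ ?_
  rw [← Subgroup.subgroupOf_normalizer_eq hAB, Subgroup.subgroupOf_inj, inf_comm, h, inf_comm,
    inf_of_le_right hAB]

end WeylGroup

/-- The poset of `p`-subgroups of a group. The trivial subgroup is included. -/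
abbrev PSubgroup (p : ℕ) (G : Type*) [Group G] : Type _ := {A : Subgroup G // IsPGroup p A}

namespace PSubgroup

variable {p : ℕ} {G H : Type*} [Group G] [Group H]

instance : OrderBot (PSubgroup p G) where
  bot := ⟨⊥, IsPGroup.of_bot⟩
  bot_le _ := bot_le (α := Subgroup G)

theorem coe_bot : ((⊥ : PSubgroup p G) : Subgroup G) = ⊥ := rfl

theorem coe_ne_bot_iff {A : PSubgroup p G} : A.1 ≠ ⊥ ↔ A ≠ ⊥ := by
  rw [ne_eq, ne_eq, Subtype.ext_iff, coe_bot]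

/-- The image of a `p`-subgroup. -/
def map (φ : G →* H) (A : PSubgroup p G) : PSubgroup p H := ⟨A.1.map φ, A.2.map φ⟩

/-- The preimage of a `p`-subgroup under a homomorphism whose kernel is a `p`-group. -/
def comap (φ : G →* H) (hφ : IsPGroup p φ.ker) (A : PSubgroup p H) : PSubgroup p G :=
  ⟨A.1.comap φ, A.2.comap_of_ker_isPGroup φ hφ⟩

theorem gc_map_comap (φ : G →* H) (hφ : IsPGroup p φ.ker) :
    GaloisConnection (map φ) (comap φ hφ) :=
  fun _ _ => Subgroup.map_le_iff_le_comap

theorem posetTheta_quotient [Finite G] (L : PSubgroup p G) [L.1.Normal] :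
    posetTheta L = posetTheta (⊥ : PSubgroup p (G ⧸ L.1)) := by
  have hker : IsPGroup p (QuotientGroup.mk' L.1).ker := by
    rw [QuotientGroup.ker_mk']
    exact L.2
  have comap_bot : (⊥ : Subgroup (G ⧸ L.1)).comap (QuotientGroup.mk' L.1) = L.1 := by
    rw [MonoidHom.comap_bot, QuotientGroup.ker_mk']
  refine posetTheta_eq_of_galoisConnection (gc_map_comap _ hker) fun A => ?_
  rw [Subtype.ext_iff, Subtype.ext_iff, coe_bot,
    ← (Subgroup.comap_injective (QuotientGroup.mk'_surjective L.1)).eq_iff, comap_bot]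
  rfl

/-- Intersecting with `N_G(A)` is an upper adjoint, and by the normalizer condition `A` is the only
`p`-subgroup that it sends to `A`. -/
theorem posetTheta_eq_posetTheta_bot_normalizerQuotient [Finite G] [Fact p.Prime]
    (A : PSubgroup p G) :
    posetTheta A = posetTheta (⊥ : PSubgroup p (NormalizerQuotient A.1)) := by
  have hker : IsPGroup p (Subgroup.normalizer (A.1 : Set G)).subtype.ker := by
    rw [Subgroup.ker_subtype]
    exact IsPGroup.of_bot
  let L := A.comap (Subgroup.normalizer (A.1 : Set G)).subtype hker
  have : L.1.Normal := Subgroup.normal_in_normalizer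
  refine Eq.trans ?_ (posetTheta_quotient L)
  refine (posetTheta_eq_of_galoisConnection (gc_map_comap _ hker) fun B =>
    ⟨fun h => Subtype.ext ?_, by rintro rfl; rfl⟩).symm
  have := B.2.isNilpotent
  refine eq_of_inf_normalizer_eq Group.normalizerCondition_of_isNilpotent ?_
  rw [Subgroup.subgroupOf_inj.1 (congrArg Subtype.val h)]
  exact inf_eq_left.2 Subgroup.le_normalizer

/-- The isomorphism of posets of `p`-subgroups induced by a group isomorphism. -/
def mapEquiv (e : G ≃* H) : PSubgroup p G ≃o PSubgroup p H where
  toFun := map e.toMonoidHom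
  invFun := map e.symm.toMonoidHom
  left_inv A := Subtype.ext (e.mapSubgroup.symm_apply_apply A.1)
  right_inv A := Subtype.ext (e.mapSubgroup.apply_symm_apply A.1)
  map_rel_iff' := Subgroup.map_le_map_iff_of_injective e.injective

instance : MulAction G (PSubgroup p G) where
  smul g A := mapEquiv (MulAut.conj g) A
  one_smul A := Subtype.ext <| by
    change A.1.map (MulAut.conj 1).toMonoidHom = A.1
    rw [map_one]
    exact Subgroup.map_id _
  mul_smul g h A := Subtype.ext <| by
    change A.1.map (MulAut.conj (g * h)).toMonoidHom =
      (A.1.map (MulAut.conj h).toMonoidHom).map (MulAut.conj g).toMonoidHom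
    rw [Subgroup.map_map, map_mul]
    rfl

theorem smul_def (g : G) (A : PSubgroup p G) : g • A = mapEquiv (MulAut.conj g) A := rfl

theorem stabilizer_eq_normalizer (A : PSubgroup p G) :
    MulAction.stabilizer G A = Subgroup.normalizer (A.1 : Set G) := by
  ext g
  rw [Subgroup.mem_normalizer_iff_map_conj_eq]
  exact Subtype.ext_iff

theorem card_smul (g : G) (A : PSubgroup p G) : Nat.card (g • A).1 = Nat.card A.1 :=
  Subgroup.card_map_of_injective (MulAut.conj g).injective

theorem smul_ne_bot_iff {g : G} {A : PSubgroup p G} : g • A ≠ ⊥ ↔ A ≠ ⊥ := by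
  rw [smul_def, ne_eq, map_eq_bot_iff]

theorem zpowers_le_iff {x : G} (hx : IsPElement p x) {A : PSubgroup p G} :
    (⟨Subgroup.zpowers x, hx.isPGroup_zpowers⟩ : PSubgroup p G) ≤ A ↔ x ∈ A.1 :=
  Subgroup.zpowers_le

theorem isPElement_of_mem (A : PSubgroup p G) {x : G} (hx : x ∈ A.1) : IsPElement p x :=
  isPElement_coe.2 (A.2 ⟨x, hx⟩)

theorem sum_card_mul_posetTheta [Finite G] [Fintype (PSubgroup p G)] :
    ∑ A : PSubgroup p G, (Nat.card A.1 : ℤ) * posetTheta A = pElementCount p G := by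
  classical
  let _ := Fintype.ofFinite G
  have card_mul (A : PSubgroup p G) :
      (Nat.card A.1 : ℤ) * posetTheta A = ∑ x : G, if x ∈ A.1 then posetTheta A else 0 := by
    rw [← Finset.sum_filter, Finset.sum_const, nsmul_eq_mul, ← Fintype.card_subtype,
      ← Nat.card_eq_fintype_card]
  simp only [card_mul]
  rw [Finset.sum_comm, pElementCount, Nat.card_eq_fintype_card, Fintype.card_subtype,
    Finset.natCast_card_filter]
  refine Finset.sum_congr rfl fun x _ => ?_
  split_ifs with hx
  · rw [← sum_posetTheta_ge (⟨_, hx.isPGroup_zpowers⟩ : PSubgroup p G),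
      Finset.sum_filter]
    simp only [zpowers_le_iff hx]
  · exact Finset.sum_eq_zero fun A _ => if_neg fun hxA => hx (A.isPElement_of_mem hxA)

theorem posetTheta_bot_add_sum_ne_bot [Finite G] [Fintype (PSubgroup p G)]
    [DecidableEq (PSubgroup p G)] :
    posetTheta (⊥ : PSubgroup p G) + ∑ A : PSubgroup p G with A ≠ ⊥, Nat.card A.1 * posetTheta A =
      pElementCount p G := by
  rw [← sum_card_mul_posetTheta, Finset.filter_ne', ← Finset.add_sum_erase _ _ (Finset.mem_univ ⊥),
    coe_bot, Subgroup.card_bot, Nat.cast_one, one_mul]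

theorem ordProj_dvd_posetTheta_bot (hp : p.Prime) (G : Type*) [Group G] [Finite G] :
    ((ordProj[p] (Nat.card G) : ℕ) : ℤ) ∣ posetTheta (⊥ : PSubgroup p G) := by
  classical
  have := Fact.mk hp
  induction hn : Nat.card G using Nat.strong_induction_on generalizing G with
  | _ n ih =>
  subst hn
  let _ := Fintype.ofFinite (PSubgroup p G)
  have hdvd := Int.natCast_dvd_natCast.2 (ordProj_dvd_pElementCount hp G)
  rw [← posetTheta_bot_add_sum_ne_bot] at hdvd
  refine (Int.dvd_add_left ?_).1 hdvd
  rw [Finset.sum_filter]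
  refine dvd_sum_of_forall_dvd_index_stabilizer_mul (G := G) (fun g A => ?_) fun A => ?_
  · rw [card_smul, if_congr smul_ne_bot_iff rfl rfl, smul_def, posetTheta_orderIso]
  · split_ifs with hA
    · have ih_normalizerQuotient :=
        ih _ (card_normalizerQuotient_lt_card (coe_ne_bot_iff.2 hA)) _ rfl
      rw [← posetTheta_eq_posetTheta_bot_normalizerQuotient] at ih_normalizerQuotient
      have ordProj_dvd : ordProj[p] (Nat.card G) ∣ (MulAction.stabilizer G A).index *
          (Nat.card A.1 * ordProj[p] (Nat.card (NormalizerQuotient A.1))) := by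
        refine (ordProj_card_dvd_index_mul_ordProj_card p (MulAction.stabilizer G A)).trans
          (mul_dvd_mul_left _ ?_)
        rw [stabilizer_eq_normalizer, ← card_normalizerQuotient_mul_card,
          Nat.ordProj_mul p Nat.card_pos.ne' Nat.card_pos.ne', mul_comm]
        exact mul_dvd_mul_right (Nat.ordProj_dvd _ _) _
      refine (Int.natCast_dvd_natCast.2 ordProj_dvd).trans ?_
      rw [Nat.cast_mul, Nat.cast_mul]
      exact mul_dvd_mul_left _ (mul_dvd_mul_left _ ih_normalizerQuotient)
    · rw [mul_zero]
      exact dvd_zero _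

section Sylow

variable [Fact p.Prime] [Finite G]

theorem posetTheta_eq_one_of_card_eq_ordProj {A : PSubgroup p G}
    (hA : Nat.card A.1 = ordProj[p] (Nat.card G)) : posetTheta A = 1 :=
  posetTheta_eq_one_of_isMax fun B hB => ((Sylow.ofCard A.1 hA).3 B.2 hB).le

theorem prime_dvd_card_normalizerQuotient {A : PSubgroup p G}
    (hA : Nat.card A.1 ≠ ordProj[p] (Nat.card G)) : p ∣ Nat.card (NormalizerQuotient A.1) := by
  have hp : p.Prime := Fact.out
  obtain ⟨k, hk⟩ := A.2.exists_card_eq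
  have k_le : k ≤ (Nat.card G).factorization p :=
    (hp.pow_dvd_iff_le_factorization Nat.card_pos.ne').1 (hk ▸ Subgroup.card_subgroup_dvd_card _)
  refine Sylow.prime_dvd_card_quotient_normalizer ?_ hk
  rw [hp.pow_dvd_iff_le_factorization Nat.card_pos.ne']
  exact k_le.lt_of_ne fun h => hA (by rw [hk, h])

theorem card_filter_card_eq_ordProj [Fintype (PSubgroup p G)] :
    (Finset.univ.filter fun A : PSubgroup p G => Nat.card A.1 = ordProj[p] (Nat.card G)).card =
      Nat.card (Sylow p G) := by
  rw [← Fintype.card_subtype, ← Nat.card_eq_fintype_card]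
  exact Nat.card_congr
    { toFun := fun A => Sylow.ofCard A.1.1 A.2
      invFun := fun P => ⟨⟨P.1, P.2⟩, P.card_eq_multiplicity⟩
      left_inv := fun _ => rfl
      right_inv := fun _ => Sylow.ext rfl }

theorem posetTheta_bot_modEq {m : ℕ} (hpG : p ∣ Nat.card G)
    (h : ∀ A : PSubgroup p G, A ≠ ⊥ → Nat.card A.1 ≠ ordProj[p] (Nat.card G) →
      (m : ℤ) ∣ posetTheta A) :
    posetTheta (⊥ : PSubgroup p G) + ↑(Nat.card (Sylow p G) * ordProj[p] (Nat.card G)) ≡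
      pElementCount p G [ZMOD m] := by
  classical
  have hp : p.Prime := Fact.out
  let _ := Fintype.ofFinite (PSubgroup p G)
  have ne_bot_of_card_eq {A : PSubgroup p G} (hA : Nat.card A.1 = ordProj[p] (Nat.card G)) :
      A ≠ ⊥ := by
    rintro rfl
    rw [coe_bot, Subgroup.card_bot] at hA
    exact hp.one_lt.ne' (Nat.dvd_one.1 (hA ▸ Nat.dvd_ordProj_of_dvd Nat.card_pos.ne' hp hpG))
  have sum_eq : ∑ A : PSubgroup p G with A ≠ ⊥,
      (if Nat.card A.1 = ordProj[p] (Nat.card G) then (ordProj[p] (Nat.card G) : ℕ) else 0 : ℤ) =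
        ↑(Nat.card (Sylow p G) * ordProj[p] (Nat.card G)) := by
    rw [← Finset.sum_filter, Finset.filter_filter,
      Finset.filter_congr fun A _ => and_iff_right_of_imp ne_bot_of_card_eq, Finset.sum_const,
      card_filter_card_eq_ordProj, nsmul_eq_mul, Nat.cast_mul]
  rw [← posetTheta_bot_add_sum_ne_bot, ← sum_eq]
  refine Int.ModEq.add_left _ (Int.ModEq.sum fun A hA => ?_)
  split_ifs with hc
  · rw [posetTheta_eq_one_of_card_eq_ordProj hc, hc, mul_one]
  · exact (Int.modEq_zero_iff_dvd.2 ((h A (Finset.mem_filter.1 hA).2 hc).mul_left _)).symm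

end Sylow

theorem dvd_posetTheta_bot {m : ℕ} (hp : p.Prime) (G : Type*) [Group G] [Finite G]
    (hpG : p ∣ Nat.card G) (hm : ∀ q, q.Prime → q ≠ p → q ∣ Nat.card G → m ∣ q - 1) :
    (m : ℤ) ∣ posetTheta (⊥ : PSubgroup p G) := by
  have := Fact.mk hp
  induction hn : Nat.card G using Nat.strong_induction_on generalizing G with
  | _ n ih =>
  subst hn
  obtain ⟨P⟩ : Nonempty (Sylow p G) := inferInstance
  have dvd_sub_one {q} (hq : q.Prime) (hqi : q ∣ P.1.index) : m ∣ q - 1 := by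
    refine hm q hq ?_ (hqi.trans P.1.index_dvd_card)
    rintro rfl
    exact P.not_dvd_index hqi
  have card_sylow_modEq : Nat.card (Sylow p G) ≡ 1 [MOD m] :=
    modEq_one_of_forall_prime Nat.card_pos.ne' fun q hq hqd =>
      dvd_sub_one hq (hqd.trans P.card_dvd_index)
  have index_modEq : P.1.index ≡ 1 [MOD m] :=
    modEq_one_of_forall_prime Subgroup.index_ne_zero_of_finite fun q => dvd_sub_one
  have pElementCount_modEq :
      Nat.card (Sylow p G) * ordProj[p] (Nat.card G) ≡ pElementCount p G [MOD m] :=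
    calc Nat.card (Sylow p G) * ordProj[p] (Nat.card G)
      _ ≡ 1 * ordProj[p] (Nat.card G) [MOD m] := card_sylow_modEq.mul_right _
      _ ≡ P.1.index * ordProj[p] (Nat.card G) [MOD m] := index_modEq.symm.mul_right _
      _ = Nat.card G := by rw [← P.card_eq_multiplicity, P.1.index_mul_card]
      _ ≡ pElementCount p G [MOD m] := (pElementCount_modEq_card hp hm).symm
  refine Int.modEq_zero_iff_dvd.1 (Int.ModEq.add_right_cancel
    (Int.natCast_modEq_iff.2 pElementCount_modEq) ?_)
  rw [zero_add]
  refine posetTheta_bot_modEq hpG fun A hA hc => ?_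
  rw [posetTheta_eq_posetTheta_bot_normalizerQuotient]
  exact ih _ (card_normalizerQuotient_lt_card (coe_ne_bot_iff.2 hA)) _
    (prime_dvd_card_normalizerQuotient hc)
    (fun q hq hqp hqd => hm q hq hqp (hqd.trans (card_normalizerQuotient_dvd_card A.1))) rfl

end PSubgroup

theorem eq_top_of_forall_exists_sylow_le {G : Type*} [Group G] [Finite G] {H : Subgroup G}
    (h : ∀ q : ℕ, q.Prime → ∃ Q : Sylow q G, (Q : Subgroup G) ≤ H) : H = ⊤ := by
  rw [← Subgroup.index_eq_one]
  by_contra hne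
  obtain ⟨q, hq, hqd⟩ := Nat.exists_prime_and_dvd hne
  have := Fact.mk hq
  obtain ⟨Q, hQ⟩ := h q hq
  exact Q.not_dvd_index (hqd.trans (Subgroup.index_dvd_of_le hQ))

theorem le_of_forall_isPElement_mem {G : Type*} [Group G] [Finite G] {H K : Subgroup G}
    (h : ∀ q : ℕ, q.Prime → ∀ x ∈ K, IsPElement q x → x ∈ H) : K ≤ H := by
  rw [← Subgroup.subgroupOf_eq_top]
  refine eq_top_of_forall_exists_sylow_le fun q hq => ?_
  obtain ⟨Q⟩ : Nonempty (Sylow q K) := inferInstance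
  exact ⟨Q, fun x hx =>
    h q hq x x.2 (isPElement_coe.2 (PSubgroup.isPElement_of_mem ⟨Q.1, Q.2⟩ hx))⟩

theorem relIndex_dvd_index_of_normal_right {G : Type*} [Group G] [Finite G] (H K : Subgroup G)
    [K.Normal] : H.relIndex K ∣ H.index := by
  have inf_relIndex_sup : (K.relIndex H) * H.relIndex (H ⊔ K) = H.relIndex K * K.relIndex H :=
    calc K.relIndex H * H.relIndex (H ⊔ K)
      _ = (H ⊓ K).relIndex (H ⊔ K) := by
        rw [← Subgroup.relIndex_mul_relIndex _ H _ inf_le_left le_sup_left,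
          Subgroup.inf_relIndex_left]
      _ = H.relIndex K * K.relIndex H := by
        rw [← Subgroup.relIndex_mul_relIndex _ K _ inf_le_right le_sup_right,
          Subgroup.inf_relIndex_right, Subgroup.relIndex_sup_right]
  rw [mul_comm (H.relIndex K)] at inf_relIndex_sup
  rw [← Nat.eq_of_mul_eq_mul_left (Nat.pos_of_ne_zero Subgroup.index_ne_zero_of_finite)
    inf_relIndex_sup]
  exact Subgroup.relIndex_dvd_index_of_le le_sup_left

theorem mem_subgroupsOfConjugates_iff {G : Type*} [Group G] {I K : Subgroup G} :
    K ∈ subgroupsOfConjugates I ↔ ∃ g : G, ∀ x ∈ K, g * x * g⁻¹ ∈ I := by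
  refine ⟨fun ⟨g, hg⟩ => ⟨g⁻¹, fun x hx => ?_⟩, fun ⟨g, hg⟩ => ⟨g⁻¹, fun x hx => ?_⟩⟩
  · simpa [mul_assoc] using Subgroup.mem_map_equiv.1 (hg hx)
  · exact ⟨g * x * g⁻¹, hg x hx, by simp [mul_assoc]⟩

/-- The subgroups all of whose `p`-elements lie in `C p`, for every prime `p`. When the `C p` are
normal and independent, these are the internal direct products of `p`-subgroups of the `C p`. -/
def primewiseIn {G : Type*} [Group G] (C : Nat.Primes → Subgroup G) : Set (Subgroup G) :=
  {K | ∀ (p : Nat.Primes), ∀ x ∈ K, IsPElement p x → x ∈ C p}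

namespace primewiseIn

variable {G : Type*} [Group G] {C : Nat.Primes → Subgroup G} {A B J K : Subgroup G}
  {p : Nat.Primes}

theorem isLowerSet : IsLowerSet (primewiseIn C) :=
  fun _ _ hBA hA p x hx => hA p x (hBA hx)

theorem bot_mem : ⊥ ∈ primewiseIn C := by
  rintro p x hx -
  rw [Subgroup.mem_bot.1 hx]
  exact one_mem _

instance : OrderBot (primewiseIn C) where
  bot := ⟨⊥, bot_mem⟩
  bot_le _ := bot_le (α := Subgroup G)

theorem coe_bot : ((⊥ : primewiseIn C) : Subgroup G) = ⊥ := rfl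

/-- The subgroup generated by the `C q` for the primes `q` other than `p`. -/
def complement (C : Nat.Primes → Subgroup G) (p : Nat.Primes) : Subgroup G := ⨆ (q) (_ : q ≠ p), C q

theorem le_complement {q : Nat.Primes} (hqp : q ≠ p) : C q ≤ complement C p :=
  le_iSup₂ (f := fun q (_ : q ≠ p) => C q) q hqp

theorem inf_sup_inf_complement [Finite G] (hK : K ∈ primewiseIn C) (p : Nat.Primes) :
    K ⊓ C p ⊔ K ⊓ complement C p = K := by
  refine le_antisymm (sup_le inf_le_left inf_le_left) (le_of_forall_isPElement_mem ?_)
  intro q hq x hx hxq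
  have hxC := hK ⟨q, hq⟩ x hx hxq
  obtain rfl | hqp := eq_or_ne ⟨q, hq⟩ p
  · exact Subgroup.mem_sup_left ⟨hx, hxC⟩
  · exact Subgroup.mem_sup_right ⟨hx, le_complement hqp hxC⟩

theorem isPGroup_subgroupOf [Finite G] (hC : iSupIndep C) (hK : K ∈ primewiseIn C)
    (p : Nat.Primes) : IsPGroup p (K.subgroupOf (C p)) := by
  refine IsPGroup.of_card (Nat.eq_prime_pow_of_unique_prime_dvd Nat.card_pos.ne' ?_)
  intro q hq hqd
  have := Fact.mk hq
  obtain ⟨x, hx⟩ := exists_prime_orderOf_dvd_card' q hqd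
  have hxq : IsPElement q ((x : C p) : G) :=
    isPElement_coe.2 (isPElement_coe.2 ⟨1, by rw [pow_one, ← hx, pow_orderOf_eq_one]⟩)
  by_contra hqp
  have disjoint := hC.pairwiseDisjoint (i := ⟨q, hq⟩) (j := p) fun h => hqp (congrArg Subtype.val h)
  have x_eq_one : ((x : C p) : G) = 1 :=
    Subgroup.disjoint_def.1 disjoint (hK ⟨q, hq⟩ _ x.2 hxq) (x : C p).2
  have : x = 1 := Subtype.ext (Subtype.ext x_eq_one)
  rw [this, orderOf_one] at hx
  exact hq.one_lt.ne hx

theorem ordProj_card_dvd_card [Finite G] (hK : K ∈ primewiseIn C) (p : Nat.Primes) :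
    ordProj[(p : ℕ)] (Nat.card K) ∣ Nat.card (C p) := by
  have := Fact.mk p.2
  obtain ⟨P⟩ : Nonempty (Sylow p K) := inferInstance
  rw [← P.card_eq_multiplicity,
    ← Subgroup.card_map_of_injective (K := P.1) K.subtype_injective]
  refine Subgroup.card_dvd_of_le ?_
  rintro _ ⟨x, hx, rfl⟩
  exact hK p x x.2 (isPElement_coe.2 (PSubgroup.isPElement_of_mem ⟨P.1, P.2⟩ hx))

variable [∀ p, (C p).Normal]

theorem prime_dvd_index [Finite G] (hC : iSupIndep C) (hK : K ∈ primewiseIn C) {q : ℕ}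
    (hq : q.Prime) (hqp : q ≠ p) (hqC : q ∣ Nat.card (C p)) : q ∣ K.index := by
  have := Fact.mk p.2
  obtain ⟨k, hk⟩ := (isPGroup_subgroupOf hC hK p).exists_card_eq
  rw [← (K.subgroupOf (C p)).card_mul_index, hk] at hqC
  have coprime : q.Coprime (p ^ k) := ((Nat.coprime_primes hq p.2).2 hqp).pow_right k
  exact (coprime.dvd_of_dvd_mul_left hqC).trans (relIndex_dvd_index_of_normal_right K (C p))

theorem commute_of_mem_complement (hC : iSupIndep C) {c d : G} (hc : c ∈ C p)
    (hd : d ∈ complement C p) : Commute c d :=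
  Subgroup.commute_of_normal_of_disjoint (C p) (complement C p) inferInstance
    (by unfold complement; infer_instance) (hC p) c d hc hd

theorem sup_mem (hC : iSupIndep C) (hA : IsPGroup p A) (hAC : A ≤ C p) (hB : B ∈ primewiseIn C)
    (hBC : B ≤ complement C p) : A ⊔ B ∈ primewiseIn C := by
  intro q x hx ⟨k, hk⟩
  have A_le_normalizer : A ≤ Subgroup.normalizer (B : Set G) :=
    le_trans (fun a ha => Subgroup.mem_centralizer_iff.2 fun b hb =>
      (commute_of_mem_complement hC (hAC ha) (hBC hb)).symm) (Subgroup.centralizer_le_normalizer _)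
  rw [← SetLike.mem_coe, Subgroup.coe_mul_of_left_le_normalizer_right A B A_le_normalizer] at hx
  obtain ⟨a, ha, b, hb, rfl⟩ := hx
  rw [(commute_of_mem_complement hC (hAC ha) (hBC hb)).mul_pow] at hk
  have a_pow : a ^ (q : ℕ) ^ k = 1 :=
    Subgroup.disjoint_def.1 (hC p) (pow_mem (hAC ha) _)
      (eq_inv_of_mul_eq_one_left hk ▸ inv_mem (pow_mem (hBC hb) _))
  rw [a_pow, one_mul] at hk
  refine mul_mem ?_ (hB q b hb ⟨k, hk⟩)
  obtain rfl | hpq := eq_or_ne p q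
  · exact hAC ha
  · obtain ⟨j, hj⟩ := PSubgroup.isPElement_of_mem ⟨A, hA⟩ ha
    rw [eq_one_of_pow_eq_one_of_coprime (Nat.coprime_pow_primes j k p.2 q.2
      fun h => hpq (Subtype.ext h)) hj a_pow]
    exact one_mem _

/-- A member of `primewiseIn C` is determined by its intersections with `C p` and with the
complement, so that `θ` at the trivial subgroup is a product with one factor from `C p`. -/
theorem posetTheta_bot_dvd [Finite G] (hC : iSupIndep C) (p : Nat.Primes) :
    posetTheta (⊥ : PSubgroup p (C p)) ∣ posetTheta (⊥ : primewiseIn C) := by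
  let R : Type _ := {K : Subgroup G // K ∈ primewiseIn C ∧ K ≤ complement C p}
  let join : PSubgroup p (C p) × R → primewiseIn C := fun x =>
    ⟨x.1.1.map (C p).subtype ⊔ x.2.1,
      sup_mem hC (x.1.2.map _) (Subgroup.map_subtype_le _) x.2.2.1 x.2.2.2⟩
  let split : primewiseIn C → PSubgroup p (C p) × R := fun K =>
    (⟨K.1.subgroupOf (C p), isPGroup_subgroupOf hC K.2 p⟩,
      ⟨K.1 ⊓ complement C p, isLowerSet inf_le_left K.2, inf_le_right⟩)
  have gc : GaloisConnection join split := fun x K => by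
    change _ ⊔ _ ≤ K.1 ↔ x.1.1 ≤ K.1.subgroupOf (C p) ∧ x.2.1 ≤ K.1 ⊓ complement C p
    rw [sup_le_iff, Subgroup.map_le_iff_le_comap, le_inf_iff, and_iff_left x.2.2.2]
    rfl
  have split_eq_bot_iff (K : primewiseIn C) : split K = (⊥, ⟨⊥, bot_mem, bot_le⟩) ↔ K = ⊥ := by
    rw [Prod.ext_iff, Subtype.ext_iff, Subtype.ext_iff, Subtype.ext_iff]
    change K.1.subgroupOf (C p) = ⊥ ∧ K.1 ⊓ complement C p = ⊥ ↔ K.1 = ⊥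
    rw [Subgroup.subgroupOf_eq_bot, disjoint_iff, ← sup_eq_bot_iff, inf_sup_inf_complement K.2]
  rw [posetTheta_eq_of_galoisConnection gc split_eq_bot_iff |>.symm, posetTheta_prod]
  exact dvd_mul_right _ _

theorem exists_sylow_eq_subgroupOf [Finite G] (hC : iSupIndep C)
    (hJ : Maximal (· ∈ primewiseIn C) J) (p : Nat.Primes) :
    ∃ P : Sylow p (C p), (P : Subgroup (C p)) = J.subgroupOf (C p) := by
  obtain ⟨P, hP⟩ := (isPGroup_subgroupOf hC hJ.1 p).exists_le_sylow
  refine ⟨P, le_antisymm ?_ hP⟩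
  have J_le : J ≤ P.1.map (C p).subtype ⊔ J ⊓ complement C p := by
    conv_lhs => rw [← inf_sup_inf_complement hJ.1 p]
    refine sup_le_sup_right ?_ _
    rw [← Subgroup.subgroupOf_map_subtype]
    exact Subgroup.map_mono hP
  exact Subgroup.map_le_iff_le_comap.1 <| le_sup_left.trans <|
    hJ.2 (sup_mem hC (P.2.map _) (Subgroup.map_subtype_le _) (isLowerSet inf_le_left hJ.1)
      inf_le_right) J_le

theorem exists_forall_conj_mem [Finite G] (hC : iSupIndep C) (hJ : Maximal (· ∈ primewiseIn C) J)
    (hK : K ∈ primewiseIn C) (p : Nat.Primes) :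
    ∃ c ∈ C p, ∀ x ∈ K, x ∈ C p → c * x * c⁻¹ ∈ J := by
  have := Fact.mk p.2
  obtain ⟨P, hP⟩ := exists_sylow_eq_subgroupOf hC hJ p
  obtain ⟨Q, hQ⟩ := (isPGroup_subgroupOf hC hK p).exists_le_sylow
  obtain ⟨c, rfl⟩ := MulAction.exists_smul_eq (C p) Q P
  refine ⟨c, c.2, fun x hx hxC => ?_⟩
  have : c * ⟨x, hxC⟩ * c⁻¹ ∈ J.subgroupOf (C p) :=
    hP ▸ Subgroup.smul_mem_pointwise_smul _ (MulAut.conj c) Q.1 (hQ hx)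
  exact this

/-- The conjugating elements found prime by prime can be multiplied together, because `C p`
centralizes `C q` for `q ≠ p`. -/
theorem mem_subgroupsOfConjugates [Finite G] (hC : iSupIndep C)
    (hJ : Maximal (· ∈ primewiseIn C) J) (hK : K ∈ primewiseIn C) :
    K ∈ subgroupsOfConjugates J := by
  choose c hc hcJ using exists_forall_conj_mem hC hJ hK
  have exists_conj_on (S : Finset Nat.Primes) : ∃ g : G,
      (∀ p ∈ S, ∀ x ∈ K, x ∈ C p → g * x * g⁻¹ ∈ J) ∧ ∀ p ∉ S, ∀ x ∈ C p, Commute g x := by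
    classical
    induction S using Finset.induction_on with
    | empty => exact ⟨1, by simp, fun _ _ x _ => Commute.one_left x⟩
    | insert p S hpS ih =>
      obtain ⟨g, hgJ, hg⟩ := ih
      have commute_c {q} (hqp : q ≠ p) {x} (hx : x ∈ C q) : Commute (c p) x :=
        commute_of_mem_complement hC (hc p) (le_complement hqp hx)
      have conj_mul (x : G) : g * c p * x * (g * c p)⁻¹ = g * (c p * x * (c p)⁻¹) * g⁻¹ := by group
      refine ⟨g * c p, fun q hq x hx hxC => ?_, fun q hq x hx => ?_⟩
      · rw [conj_mul]
        rcases Finset.mem_insert.1 hq with rfl | hqS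
        · rw [(hg q hpS _ (Subgroup.Normal.conj_mem inferInstance x hxC _)).eq,
            mul_inv_cancel_right]
          exact hcJ q x hx hxC
        · rw [(commute_c (ne_of_mem_of_not_mem hqS hpS) hxC).eq, mul_inv_cancel_right]
          exact hgJ q hqS x hx hxC
      · rw [Finset.mem_insert, not_or] at hq
        exact (hg q hq.2 x hx).mul_left (commute_c hq.1 hx)
  have finite_ne_bot : {p | C p ≠ ⊥}.Finite := WellFoundedGT.finite_ne_bot_of_iSupIndep hC
  obtain ⟨g, hgJ, -⟩ := exists_conj_on finite_ne_bot.toFinset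
  refine mem_subgroupsOfConjugates_iff.2 ⟨g, ?_⟩
  change K ≤ J.comap (MulAut.conj g).toMonoidHom
  refine le_of_forall_isPElement_mem fun q hq x hx hxq => ?_
  have hxC := hK ⟨q, hq⟩ x hx hxq
  by_cases hCq : C ⟨q, hq⟩ = ⊥
  · rw [hCq, Subgroup.mem_bot] at hxC
    rw [hxC]
    exact one_mem _
  · exact hgJ ⟨q, hq⟩ (finite_ne_bot.mem_toFinset.2 hCq) x hx hxC

end primewiseIn

section Nilpotent

variable {G : Type*} [Group G]

theorem isNilpotent_of_le {H K : Subgroup G} (hHK : H ≤ K) (hK : Group.IsNilpotent K) :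
    Group.IsNilpotent H :=
  Group.nilpotent_of_mulEquiv (_h := Subgroup.isNilpotent (hG := hK) _)
    (Subgroup.subgroupOfEquivOfLe hHK)

theorem isNilpotent_map {G' : Type*} [Group G'] (φ : G →* G') {K : Subgroup G}
    (hK : Group.IsNilpotent K) : Group.IsNilpotent (K.map φ) :=
  Group.nilpotent_of_surjective (h := hK) (φ.subgroupMap K) (φ.subgroupMap_surjective K)

theorem commute_of_pow_eq_one_of_coprime [Finite G] (hG : Group.IsNilpotent G) {a b : ℕ}
    (hab : a.Coprime b) {x y : G} (hx : x ^ a = 1) (hy : y ^ b = 1) : Commute x y := by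
  have in_isPGroup {p : ℕ} {P : Subgroup G} (hp : p.Prime) (hP : IsPGroup p P) {u v : P}
      (hu : u ^ a = 1) (hv : v ^ b = 1) : Commute u v := by
    by_cases hpa : p ∣ a
    · obtain ⟨k, hk⟩ := hP v
      rw [eq_one_of_pow_eq_one_of_coprime ((hab.coprime_dvd_left hpa).pow_left k) hk hv]
      exact Commute.one_right u
    · obtain ⟨k, hk⟩ := hP u
      rw [eq_one_of_pow_eq_one_of_coprime ((hp.coprime_iff_not_dvd.2 hpa).pow_left k) hk hu]
      exact Commute.one_left v
  obtain ⟨e⟩ := ((Group.isNilpotent_of_finite_tfae (G := G)).out 0 4).1 hG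
  have commute_symm : Commute (e.symm x) (e.symm y) := by
    funext p P
    refine in_isPGroup (Nat.prime_of_mem_primeFactors p.2) P.2 ?_ ?_
    · exact congrFun (congrFun ((map_pow e.symm x a).symm.trans (hx ▸ map_one e.symm)) p) P
    · exact congrFun (congrFun ((map_pow e.symm y b).symm.trans (hy ▸ map_one e.symm)) p) P
  simpa only [MulEquiv.apply_symm_apply] using commute_symm.map e

theorem commute_of_mem_of_pow_eq_one_of_coprime {K : Subgroup G} [Finite K]
    (hK : Group.IsNilpotent K) {a b : ℕ} (hab : a.Coprime b) {x y : G} (hxK : x ∈ K) (hyK : y ∈ K)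
    (hx : x ^ a = 1) (hy : y ^ b = 1) : Commute x y :=
  congrArg Subtype.val (commute_of_pow_eq_one_of_coprime hK hab (x := ⟨x, hxK⟩) (y := ⟨y, hyK⟩)
    (Subtype.ext hx) (Subtype.ext hy)).eq

theorem isNilpotent_of_commute_isPElement [Finite G]
    (h : ∀ p q : Nat.Primes, p ≠ q → ∀ x y : G, IsPElement p x → IsPElement q y → Commute x y) :
    Group.IsNilpotent G := by
  refine ((Group.isNilpotent_of_finite_tfae (G := G)).out 0 3).2 fun p hp P => ?_
  rw [← Subgroup.normalizer_eq_top_iff]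
  refine eq_top_of_forall_exists_sylow_le fun q hq => ?_
  obtain rfl | hpq := eq_or_ne p q
  · exact ⟨P, Subgroup.le_normalizer⟩
  · obtain ⟨Q⟩ : Nonempty (Sylow q G) := inferInstance
    refine ⟨Q, le_trans ?_ (Subgroup.centralizer_le_normalizer _)⟩
    exact fun y hy => Subgroup.mem_centralizer_iff.2 fun x hx =>
      (h ⟨p, hp.out⟩ ⟨q, hq⟩ (fun h => hpq (congrArg Subtype.val h)) x y
        (PSubgroup.isPElement_of_mem ⟨P.1, P.2⟩ hx) (PSubgroup.isPElement_of_mem ⟨Q.1, Q.2⟩ hy)).eq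

end Nilpotent

section TorsionCentralizer

variable {G : Type*} [Group G] {F : Subgroup G} {a b : ℕ}

/-- The centralizer of the elements of `F` of order dividing `n`. When `F` is finite and nilpotent
and `n` is the `π`-part of its order, this is the centralizer of the Hall `π`-subgroup of `F`. -/
def torsionCentralizer (F : Subgroup G) (n : ℕ) : Subgroup G :=
  Subgroup.centralizer {x | x ∈ F ∧ x ^ n = 1}

theorem mem_torsionCentralizer {n : ℕ} {c : G} :
    c ∈ torsionCentralizer F n ↔ ∀ x ∈ F, x ^ n = 1 → Commute c x := by
  rw [torsionCentralizer, Subgroup.mem_centralizer_iff]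
  exact ⟨fun h x hx hxn => (h x ⟨hx, hxn⟩).symm, fun h x hx => (h x hx.1 hx.2).symm⟩

theorem torsionCentralizer_anti (F : Subgroup G) (hab : a ∣ b) :
    torsionCentralizer F b ≤ torsionCentralizer F a :=
  Subgroup.centralizer_le fun _ hx => ⟨hx.1, orderOf_dvd_iff_pow_eq_one.1
    ((orderOf_dvd_of_pow_eq_one hx.2).trans hab)⟩

instance torsionCentralizer_normal [hF : F.Normal] (n : ℕ) : (torsionCentralizer F n).Normal where
  conj_mem c hc g := by
    rw [mem_torsionCentralizer] at hc ⊢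
    intro x hx hxn
    have conj_pow_eq_one : (g⁻¹ * x * g⁻¹⁻¹) ^ n = 1 := by
      rw [conj_pow, hxn, mul_one, mul_inv_cancel]
    simpa [mul_assoc] using
      (hc _ (hF.conj_mem x hx g⁻¹) conj_pow_eq_one).map (MulAut.conj g)

theorem mem_centralizer_of_mem_torsionCentralizer (hab : a.Coprime b)
    (hFab : ∀ f ∈ F, f ^ (a * b) = 1) {c : G} (hca : c ∈ torsionCentralizer F a)
    (hcb : c ∈ torsionCentralizer F b) : c ∈ Subgroup.centralizer (F : Set G) := by
  refine Subgroup.mem_centralizer_iff.2 fun f hf => ?_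
  rw [← pow_coprimeExponent_mul_pow_coprimeExponent hab (hFab f hf)]
  refine (Commute.mul_right ?_ ?_).eq.symm
  · exact mem_torsionCentralizer.1 hca _ (pow_mem hf _)
      (pow_coprimeExponent_pow_eq_one hab (hFab f hf))
  · exact mem_torsionCentralizer.1 hcb _ (pow_mem hf _)
      (pow_coprimeExponent_pow_eq_one hab.symm (mul_comm a b ▸ hFab f hf))

theorem isMulCommutative_centralizer (hF : Subgroup.centralizer (F : Set G) ≤ F) :
    IsMulCommutative (Subgroup.centralizer (F : Set G)) :=
  ⟨⟨fun x y => Subtype.ext (Subgroup.mem_centralizer_iff.1 y.2 x (hF x.2))⟩⟩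

section Nilpotent

variable [Finite F] (hF : Group.IsNilpotent F) (hab : a.Coprime b)
  (hFab : ∀ f ∈ F, f ^ (a * b) = 1)

include hF hab

theorem mem_torsionCentralizer_of_pow_eq_one {f : G} (hf : f ∈ F) (hfa : f ^ a = 1) :
    f ∈ torsionCentralizer F b :=
  mem_torsionCentralizer.2 fun _ hx hxb =>
    commute_of_mem_of_pow_eq_one_of_coprime hF hab hf hx hfa hxb

include hFab

theorem mul_mem_torsionCentralizer {c f : G} (hc : c ∈ torsionCentralizer F b) (hf : f ∈ F)
    (hcf : (c * f) ^ a = 1) : c * f ∈ torsionCentralizer F b := by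
  set u := f ^ coprimeExponent hab
  set v := f ^ coprimeExponent hab.symm
  have hv : v ^ b = 1 := pow_coprimeExponent_pow_eq_one hab.symm (mul_comm a b ▸ hFab f hf)
  have cu_mem : c * u ∈ torsionCentralizer F b :=
    mul_mem hc <| mem_torsionCentralizer_of_pow_eq_one hF hab (pow_mem hf _)
      (pow_coprimeExponent_pow_eq_one hab (hFab f hf))
  have cu_commute_v : Commute (c * u) v := mem_torsionCentralizer.1 cu_mem v (pow_mem hf _) hv
  have cf_eq : c * f = (c * u) ^ coprimeExponent hab :=
    calc c * f = (c * f) ^ coprimeExponent hab := (pow_coprimeExponent_eq_self hab hcf).symm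
      _ = (c * u * v) ^ coprimeExponent hab := by
        rw [mul_assoc, pow_coprimeExponent_mul_pow_coprimeExponent hab (hFab f hf)]
      _ = (c * u) ^ coprimeExponent hab := by
        rw [cu_commute_v.mul_pow, pow_coprimeExponent_eq_one hab hv, mul_one]
  exact cf_eq ▸ pow_mem cu_mem _

theorem disjoint_map_torsionCentralizer [F.Normal]
    (hCF : Subgroup.centralizer (F : Set G) ≤ F) :
    Disjoint ((torsionCentralizer F a).map (QuotientGroup.mk' F))
      ((torsionCentralizer F b).map (QuotientGroup.mk' F)) := by
  rw [Subgroup.disjoint_def]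
  rintro _ ⟨c, hc, rfl⟩ ⟨d, hd, hdc⟩
  have hf : d⁻¹ * c ∈ F := QuotientGroup.eq.1 hdc
  set u := (d⁻¹ * c) ^ coprimeExponent hab
  set v := (d⁻¹ * c) ^ coprimeExponent hab.symm
  have du_eq : d * u = c * v⁻¹ := by
    rw [eq_mul_inv_iff_mul_eq, mul_assoc,
      pow_coprimeExponent_mul_pow_coprimeExponent hab (hFab _ hf), mul_inv_cancel_left]
  have du_mem : d * u ∈ torsionCentralizer F b :=
    mul_mem hd <| mem_torsionCentralizer_of_pow_eq_one hF hab (pow_mem hf _)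
      (pow_coprimeExponent_pow_eq_one hab (hFab _ hf))
  have cv_mem : c * v⁻¹ ∈ torsionCentralizer F a :=
    mul_mem hc <| inv_mem <| mem_torsionCentralizer_of_pow_eq_one hF hab.symm (pow_mem hf _)
      (pow_coprimeExponent_pow_eq_one hab.symm (mul_comm a b ▸ hFab _ hf))
  have cv_mem_F : c * v⁻¹ ∈ F :=
    hCF (mem_centralizer_of_mem_torsionCentralizer hab hFab cv_mem (du_eq ▸ du_mem))
  exact (QuotientGroup.eq_one_iff c).2 ((mul_mem_cancel_right (inv_mem (pow_mem hf _))).1 cv_mem_F)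

end Nilpotent

section Commute

variable [F.Normal] (hCF : Subgroup.centralizer (F : Set G) ≤ F) (hab : a.Coprime b)
  (hFab : ∀ f ∈ F, f ^ (a * b) = 1) {x y : G}

include hCF hab hFab

/-- The commutator `z` lies in the abelian group `C_G(F)`. Modulo the `a`-torsion of that group,
`z` is a `b`-element commuting with `x`, so `z ^ a = (x * z) ^ a` is a conjugate of `x ^ a = 1`. -/
theorem commutator_pow_eq_one (hx : x ∈ torsionCentralizer F b) (hxa : x ^ a = 1)
    (hy : y ∈ torsionCentralizer F a) : (x⁻¹ * (y * x * y⁻¹)) ^ a = 1 := by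
  set z := x⁻¹ * (y * x * y⁻¹) with hz
  have hzb : z ∈ torsionCentralizer F b :=
    mul_mem (inv_mem hx) (Subgroup.Normal.conj_mem inferInstance x hx y)
  have hza : z ∈ torsionCentralizer F a := by
    rw [hz, ← mul_assoc, ← mul_assoc]
    exact mul_mem (Subgroup.Normal.conj_mem' inferInstance y hy x) (inv_mem hy)
  have hzC := mem_centralizer_of_mem_torsionCentralizer hab hFab hza hzb
  have := isMulCommutative_centralizer hCF
  let N := commTorsion (Subgroup.centralizer (F : Set G)) a
  set u := z ^ coprimeExponent hab
  set v := z ^ coprimeExponent hab.symm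
  have hu : u ∈ N := ⟨pow_mem hzC _, pow_coprimeExponent_pow_eq_one hab (hFab z (hCF hzC))⟩
  have hv : v ^ b = 1 := pow_coprimeExponent_pow_eq_one hab.symm (mul_comm a b ▸ hFab z (hCF hzC))
  have mk_v : (v : G ⧸ N) = z := by
    rw [← pow_coprimeExponent_mul_pow_coprimeExponent hab (hFab z (hCF hzC)), QuotientGroup.mk_mul,
      (QuotientGroup.eq_one_iff u).2 hu, one_mul]
  have x_commute_v : Commute x v := mem_torsionCentralizer.1 hx v (pow_mem (hCF hzC) _) hv
  have mk_v_pow : (v : G ⧸ N) ^ a = 1 :=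
    calc (v : G ⧸ N) ^ a = ((x ^ a * v ^ a : G) : G ⧸ N) := by
          rw [hxa, one_mul, QuotientGroup.mk_pow _ v]
      _ = (x * z : G ⧸ N) ^ a := by
        rw [← x_commute_v.mul_pow, QuotientGroup.mk_pow, QuotientGroup.mk_mul, mk_v]
      _ = ((y * x * y⁻¹ : G) : G ⧸ N) ^ a := by rw [← QuotientGroup.mk_mul, hz, mul_inv_cancel_left]
      _ = 1 := by
        rw [← QuotientGroup.mk_pow, conj_pow, hxa, mul_one, mul_inv_cancel, QuotientGroup.mk_one]
  have mk_v_eq_one := eq_one_of_pow_eq_one_of_coprime hab mk_v_pow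
    (by rw [← QuotientGroup.mk_pow, hv, QuotientGroup.mk_one])
  have hz_mem : z ∈ N := (QuotientGroup.eq_one_iff z).1 (mk_v.symm.trans mk_v_eq_one)
  exact hz_mem.2

theorem commute_of_mem_torsionCentralizer (hx : x ∈ torsionCentralizer F b) (hxa : x ^ a = 1)
    (hy : y ∈ torsionCentralizer F a) (hyb : y ^ b = 1) : Commute x y := by
  have xy_pow := commutator_pow_eq_one hCF hab hFab hx hxa hy
  have yx_pow := commutator_pow_eq_one hCF hab.symm (mul_comm a b ▸ hFab) hy hyb hx
  have inv_conj : (x * y⁻¹) * (x⁻¹ * (y * x * y⁻¹))⁻¹ * (x * y⁻¹)⁻¹ = y⁻¹ * (x * y * x⁻¹) := by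
    group
  have yx_eq_one : y⁻¹ * (x * y * x⁻¹) = 1 := by
    refine eq_one_of_pow_eq_one_of_coprime hab ?_ yx_pow
    rw [← inv_conj, conj_pow, inv_pow, xy_pow, inv_one, mul_one, mul_inv_cancel]
  rw [inv_mul_eq_one, eq_mul_inv_iff_mul_eq] at yx_eq_one
  exact yx_eq_one.symm

end Commute

end TorsionCentralizer

theorem pow_ordProj_mul_ordCompl_card {G : Type*} [Group G] (p : Nat.Primes) (x : G) :
    x ^ (ordProj[(p : ℕ)] (Nat.card G) * ordCompl[(p : ℕ)] (Nat.card G)) = 1 := by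
  rw [Nat.ordProj_mul_ordCompl_eq_self, pow_card_eq_one']

theorem ordProj_dvd_ordCompl {p q : Nat.Primes} (hpq : p ≠ q) (n : ℕ) :
    ordProj[(p : ℕ)] n ∣ ordCompl[(q : ℕ)] n := by
  refine (Nat.coprime_pow_primes _ (n.factorization q) p.2 q.2
    (Subtype.coe_ne_coe.2 hpq)).dvd_of_dvd_mul_left ?_
  rw [Nat.ordProj_mul_ordCompl_eq_self]
  exact Nat.ordProj_dvd n p

section PrimeCentralizer

variable {G : Type*} [Group G] (F : Subgroup G) [F.Normal]

/-- The image in `G ⧸ F` of the centralizer of the elements of `F` of order prime to `p`. For `F`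
nilpotent with `C_G(F) ≤ F`, a subgroup containing `F` is nilpotent exactly when its image in
`G ⧸ F` is in `primewiseIn (primeCentralizer F)`. -/
noncomputable def primeCentralizer (p : Nat.Primes) : Subgroup (G ⧸ F) :=
  (torsionCentralizer F (ordCompl[(p : ℕ)] (Nat.card G))).map (QuotientGroup.mk' F)

instance primeCentralizer_normal (p : Nat.Primes) : (primeCentralizer F p).Normal :=
  Subgroup.Normal.map inferInstance _ (QuotientGroup.mk'_surjective F)

theorem primeCentralizer_le_map_torsionCentralizer {p q : Nat.Primes} (hqp : q ≠ p) :
    primeCentralizer F q ≤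
      (torsionCentralizer F (ordProj[(p : ℕ)] (Nat.card G))).map (QuotientGroup.mk' F) :=
  Subgroup.map_mono (torsionCentralizer_anti F (ordProj_dvd_ordCompl hqp.symm _))

variable {F} [Finite G]

theorem iSupIndep_primeCentralizer (hF : Group.IsNilpotent F)
    (hCF : Subgroup.centralizer (F : Set G) ≤ F) : iSupIndep (primeCentralizer F) := fun p =>
  (disjoint_map_torsionCentralizer hF (coprime_ordProj_ordCompl_card p.2 G)
    (fun f _ => pow_ordProj_mul_ordCompl_card p f) hCF).symm.mono_right
    (iSup₂_le fun _ hqp => primeCentralizer_le_map_torsionCentralizer F hqp)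

theorem map_mem_primewiseIn {K : Subgroup G} (hFK : F ≤ K) (hK : Group.IsNilpotent K) :
    K.map (QuotientGroup.mk' F) ∈ primewiseIn (primeCentralizer F) := by
  rintro p _ ⟨x, hx, rfl⟩ hxp
  have coprime := coprime_ordProj_ordCompl_card p.2 G
  have mk_pow : QuotientGroup.mk' F x ^ ordProj[(p : ℕ)] (Nat.card G) = 1 :=
    hxp.pow_ordProj_eq_one p.2 Nat.card_pos.ne' (by rw [← map_pow, pow_card_eq_one', map_one])
  refine ⟨x ^ coprimeExponent coprime, mem_torsionCentralizer.2 fun f hf hfb => ?_, ?_⟩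
  · exact commute_of_mem_of_pow_eq_one_of_coprime hK coprime (pow_mem hx _) (hFK hf)
      (pow_coprimeExponent_pow_eq_one coprime (pow_ordProj_mul_ordCompl_card p x)) hfb
  · rw [map_pow, pow_coprimeExponent_eq_self coprime mk_pow]

theorem ordProj_relIndex_dvd_card_primeCentralizer {K : Subgroup G} (hFK : F ≤ K)
    (hK : Group.IsNilpotent K) (p : Nat.Primes) :
    ordProj[(p : ℕ)] (F.relIndex K) ∣ Nat.card (primeCentralizer F p) := by
  have card_map_eq : Nat.card (K.map (QuotientGroup.mk' F)) = F.relIndex K := by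
    rw [← Subgroup.relIndex_ker, QuotientGroup.ker_mk']
  exact card_map_eq ▸ primewiseIn.ordProj_card_dvd_card (map_mem_primewiseIn hFK hK) p

theorem mem_torsionCentralizer_of_mem_comap (hF : Group.IsNilpotent F) {K : Subgroup (G ⧸ F)}
    (hK : K ∈ primewiseIn (primeCentralizer F)) {p : Nat.Primes} {x : G}
    (hx : x ∈ K.comap (QuotientGroup.mk' F)) (hxp : IsPElement p x) :
    x ∈ torsionCentralizer F (ordCompl[(p : ℕ)] (Nat.card G)) := by
  obtain ⟨c, hc, hcx⟩ := hK p _ hx (hxp.map _)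
  have x_eq : c * (c⁻¹ * x) = x := mul_inv_cancel_left c x
  rw [← x_eq]
  exact mul_mem_torsionCentralizer hF (coprime_ordProj_ordCompl_card p.2 G)
    (fun f _ => pow_ordProj_mul_ordCompl_card p f) hc (QuotientGroup.eq.1 hcx)
    (x_eq.symm ▸ (isPElement_iff_pow_ordProj_card_eq_one p.2).1 hxp)

theorem isNilpotent_comap (hF : Group.IsNilpotent F)
    (hCF : Subgroup.centralizer (F : Set G) ≤ F) {K : Subgroup (G ⧸ F)}
    (hK : K ∈ primewiseIn (primeCentralizer F)) :
    Group.IsNilpotent (K.comap (QuotientGroup.mk' F)) := by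
  refine isNilpotent_of_commute_isPElement fun p q hpq x y hx hy => Subtype.ext ?_
  replace hx := isPElement_coe.2 hx
  replace hy := isPElement_coe.2 hy
  exact commute_of_mem_torsionCentralizer hCF (coprime_ordProj_ordCompl_card p.2 G)
    (fun f _ => pow_ordProj_mul_ordCompl_card p f)
    (mem_torsionCentralizer_of_mem_comap hF hK x.2 hx)
    ((isPElement_iff_pow_ordProj_card_eq_one p.2).1 hx)
    (torsionCentralizer_anti F (ordProj_dvd_ordCompl hpq _)
      (mem_torsionCentralizer_of_mem_comap hF hK y.2 hy))
    (orderOf_dvd_iff_pow_eq_one.1 <|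
      (orderOf_dvd_of_pow_eq_one ((isPElement_iff_pow_ordProj_card_eq_one q.2).1 hy)).trans
        (ordProj_dvd_ordCompl hpq.symm _))

end PrimeCentralizer

section MaximalNilpotent

variable {G : Type*} [Group G] {F I : Subgroup G}

theorem self_mem_subgroupsOfConjugates (hFI : F ≤ I) : F ∈ subgroupsOfConjugates I :=
  mem_subgroupsOfConjugates_iff.2 ⟨1, fun x hx => by simpa using hFI hx⟩

theorem isNilpotent_of_mem_subgroupsOfConjugates (hI : Group.IsNilpotent I) {K : Subgroup G}
    (hK : K ∈ subgroupsOfConjugates I) : Group.IsNilpotent K :=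
  let ⟨_, hg⟩ := hK
  isNilpotent_of_le hg (isNilpotent_map _ hI)

variable [Finite G] [F.Normal] (hCF : Subgroup.centralizer (F : Set G) ≤ F)
  (hI : Maximal (fun K : Subgroup G => Group.IsNilpotent K) I) (hFI : F ≤ I)

include hCF hI hFI

theorem maximal_map_mem_primewiseIn :
    Maximal (· ∈ primewiseIn (primeCentralizer F)) (I.map (QuotientGroup.mk' F)) := by
  refine ⟨map_mem_primewiseIn hFI hI.1, fun K hK hIK => ?_⟩
  have comap_le := hI.2 (isNilpotent_comap (isNilpotent_of_le hFI hI.1) hCF hK)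
    (Subgroup.map_le_iff_le_comap.1 hIK)
  rw [← Subgroup.map_comap_eq_self_of_surjective (QuotientGroup.mk'_surjective F) K]
  exact Subgroup.map_mono comap_le

theorem comap_mem_subgroupsOfConjugates {K : Subgroup (G ⧸ F)}
    (hK : K ∈ primewiseIn (primeCentralizer F)) :
    K.comap (QuotientGroup.mk' F) ∈ subgroupsOfConjugates I := by
  have hKI := primewiseIn.mem_subgroupsOfConjugates
    (iSupIndep_primeCentralizer (isNilpotent_of_le hFI hI.1) hCF)
    (maximal_map_mem_primewiseIn hCF hI hFI) hK
  rw [mem_subgroupsOfConjugates_iff] at hKI ⊢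
  obtain ⟨g, hg⟩ := hKI
  obtain ⟨g, rfl⟩ := QuotientGroup.mk'_surjective F g
  refine ⟨g, fun x hx => ?_⟩
  have comap_map_eq : (I.map (QuotientGroup.mk' F)).comap (QuotientGroup.mk' F) = I := by
    rw [Subgroup.comap_map_eq, QuotientGroup.ker_mk', sup_eq_left.2 hFI]
  rw [← comap_map_eq, Subgroup.mem_comap]
  exact hg _ hx

theorem posetTheta_eq_posetTheta_bot_primewiseIn :
    posetTheta (⟨F, self_mem_subgroupsOfConjugates hFI⟩ : subgroupsOfConjugates I) =
      posetTheta (⊥ : primewiseIn (primeCentralizer F)) := by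
  let e : primewiseIn (primeCentralizer F) ↪o subgroupsOfConjugates I := OrderEmbedding.ofMapLEIff
    (fun K => ⟨K.1.comap (QuotientGroup.mk' F), comap_mem_subgroupsOfConjugates hCF hI hFI K.2⟩)
    fun _ _ => Subgroup.comap_le_comap_of_surjective (QuotientGroup.mk'_surjective F)
  have e_bot : e ⊥ = ⟨F, self_mem_subgroupsOfConjugates hFI⟩ :=
    Subtype.ext ((MonoidHom.comap_bot _).trans (QuotientGroup.ker_mk' F))
  have isUpperSet_range : IsUpperSet (Set.range e) := by
    rintro _ L hKL ⟨K, rfl⟩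
    have hFL : F ≤ L := (congrArg Subtype.val e_bot).ge.trans ((e.monotone bot_le).trans hKL)
    refine ⟨⟨L.1.map (QuotientGroup.mk' F),
      map_mem_primewiseIn hFL (isNilpotent_of_mem_subgroupsOfConjugates hI.1 L.2)⟩, ?_⟩
    refine Subtype.ext ((Subgroup.comap_map_eq _ _).trans ?_)
    rw [QuotientGroup.ker_mk', sup_eq_left.2 hFL]
  rw [← e_bot, posetTheta_apply_of_isUpperSet_range e isUpperSet_range]

theorem posetTheta_bot_primeCentralizer_dvd (p : Nat.Primes) :
    posetTheta (⊥ : PSubgroup p (primeCentralizer F p)) ∣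
      posetTheta (⟨F, self_mem_subgroupsOfConjugates hFI⟩ : subgroupsOfConjugates I) :=
  posetTheta_eq_posetTheta_bot_primewiseIn hCF hI hFI ▸ primewiseIn.posetTheta_bot_dvd
    (iSupIndep_primeCentralizer (isNilpotent_of_le hFI hI.1) hCF) p

theorem relIndex_dvd_posetTheta :
    (F.relIndex I : ℤ) ∣
      posetTheta (⟨F, self_mem_subgroupsOfConjugates hFI⟩ : subgroupsOfConjugates I) := by
  rw [Int.natCast_dvd, Nat.dvd_iff_prime_pow_dvd_dvd]
  intro p k hp hk
  refine Dvd.dvd.trans ?_ <| Int.natCast_dvd.1 <|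
    (PSubgroup.ordProj_dvd_posetTheta_bot hp (primeCentralizer F ⟨p, hp⟩)).trans
      (posetTheta_bot_primeCentralizer_dvd hCF hI hFI ⟨p, hp⟩)
  refine pow_dvd_pow p ((hp.pow_dvd_iff_le_factorization Nat.card_pos.ne').1 ?_)
  refine Dvd.dvd.trans ?_ (ordProj_relIndex_dvd_card_primeCentralizer hFI hI.1 ⟨p, hp⟩)
  exact pow_dvd_pow p
    ((hp.pow_dvd_iff_le_factorization Subgroup.index_ne_zero_of_finite).1 hk)

theorem dvd_posetTheta (hn : F.relIndex I ≠ 1) {m : ℕ}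
    (hm : ∀ q : ℕ, q.Prime → q ∣ I.index → m ∣ q - 1) :
    (m : ℤ) ∣ posetTheta (⟨F, self_mem_subgroupsOfConjugates hFI⟩ : subgroupsOfConjugates I) := by
  obtain ⟨p, hp, hpn⟩ := Nat.exists_prime_and_dvd hn
  let p : Nat.Primes := ⟨p, hp⟩
  have index_map_eq : (I.map (QuotientGroup.mk' F)).index = I.index :=
    Subgroup.index_map_eq I (QuotientGroup.mk'_surjective F) (by rwa [QuotientGroup.ker_mk'])
  have dvd_card : (p : ℕ) ∣ Nat.card (primeCentralizer F p) :=
    (dvd_pow_self _ (p.2.factorization_pos_of_dvd Subgroup.index_ne_zero_of_finite hpn).ne').trans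
      (ordProj_relIndex_dvd_card_primeCentralizer hFI hI.1 p)
  refine (PSubgroup.dvd_posetTheta_bot p.2 _ dvd_card fun q hq hqp hqC => hm q hq ?_).trans
    (posetTheta_bot_primeCentralizer_dvd hCF hI hFI p)
  rw [← index_map_eq]
  exact primewiseIn.prime_dvd_index
    (iSupIndep_primeCentralizer (isNilpotent_of_le hFI hI.1) hCF)
    (map_mem_primewiseIn hFI hI.1) hq hqp hqC

end MaximalNilpotent

section Injector

variable {G : Type*} [Group G] {I : Subgroup G}

instance fittingSubgroup_normal : (fittingSubgroup G).Normal :=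
  Subgroup.sSup_normal _ fun _ h => h.1

theorem IsNilpotentInjector.maximal (hI : IsNilpotentInjector I) :
    Maximal (fun K : Subgroup G => Group.IsNilpotent K) I := by
  simpa only [le_top, true_and, top_inf_eq] using hI ⊤ Subgroup.IsSubnormal.top

theorem IsNilpotentInjector.fittingSubgroup_le (hI : IsNilpotentInjector I) :
    fittingSubgroup G ≤ I :=
  sSup_le fun N hN =>
    ((hI N hN.1.isSubnormal).2 ⟨le_rfl, hN.2⟩ inf_le_left).trans inf_le_right

theorem IsNilpotentInjector.injectorModulus_dvd [Finite G] (hI : IsNilpotentInjector I) {q : ℕ}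
    (hq : q.Prime) (hqI : q ∣ I.index) : injectorModulus G ∣ q - 1 := by
  classical
  unfold injectorModulus
  split_ifs
  · exact one_dvd _
  · exact Finset.gcd_dvd (Finset.mem_filter.2 ⟨Nat.mem_primeFactors.2
      ⟨hq, hqI.trans I.index_dvd_card, Nat.card_pos.ne'⟩, I, hI, hqI⟩)

end Injector

theorem mainTheorem8_general {G : Type*} [Group G] [Finite G] {F I : Subgroup G} [F.Normal]
    (hCF : Subgroup.centralizer (F : Set G) ≤ F)
    (hI : Maximal (fun K : Subgroup G => Group.IsNilpotent K) I) (hFI : F ≤ I)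
    (hn : 1 < F.relIndex I) {m : ℕ} (hm : ∀ q : ℕ, q.Prime → q ∣ I.index → m ∣ q - 1) :
    ∃ hF : F ∈ subgroupsOfConjugates I,
      ((Nat.lcm m (F.relIndex I) : ℕ) : ℤ) ∣
        posetTheta (⟨F, hF⟩ : subgroupsOfConjugates I) :=
  ⟨self_mem_subgroupsOfConjugates hFI, Int.natCast_dvd.2 <| Nat.lcm_dvd
    (Int.natCast_dvd.1 (dvd_posetTheta hCF hI hFI hn.ne' hm))
    (Int.natCast_dvd.1 (relIndex_dvd_posetTheta hCF hI hFI))⟩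

theorem mainTheorem8 {G : Type*} [Group G] [Finite G] [Nontrivial G]
    (hG : IsNConstrained G) (I : Subgroup G) (hI : IsNilpotentInjector I)
    (hn : 1 < (fittingSubgroup G).relIndex I) :
    ∃ hF : fittingSubgroup G ∈ subgroupsOfConjugates I,
      ((Nat.lcm (injectorModulus G) ((fittingSubgroup G).relIndex I) : ℕ) : ℤ) ∣
        posetTheta (⟨fittingSubgroup G, hF⟩ : subgroupsOfConjugates I) :=
  mainTheorem8_general hG hI.maximal hI.fittingSubgroup_le hn fun _ => hI.injectorModulus_dvd
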